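/- **Representer theorem for direct-product spaces.** *Conventions.* All spaces are real. For a normed space $X$ with dual $X'$, the duality mapping is $J_X(\nu)=\{f\in X' : \|f\|=\|\nu\|,\ \langle f,\nu\rangle=\|\nu\|\,\|f\|\}$; elements of $J_X(\nu)$ are called Banach conjugates of $\nu$. When $J_X$ is single-valued, $\mathrm J_X\{\nu\}$ denotes its unique value. $\mathrm{Ext}(C)$ is the set of extreme points of $C$, and $B_{X'}$ is the closed unit ball of $X'$. *Setting.* Let $X_1,\dots,X_N$ be Banach spaces and let $Z=(\mathbb R^N,\|\cdot\|_Z)$ with an absolute norm, i.e. $\|(|z_n|)\|_Z=\|z\|_Z$, with dual norm $\|\cdot\|_{Z'}$. Let $X=(X_1\times\dots\times X_N)_Z$ be the product with norm $\|(\|x_1\|,\dots,\|x_N\|)\|_Z$. Its dual is $X'=(X_1'\times\dots\times X_N')_{Z'}$, under $\langle f,x\rangle=\sum_n\langle f_n,x_n\rangle$. Let $\nu_1,\dots,\nu_M\in X$ be linearly independent, $\nu_m=(\nu_{m,1},\dots,\nu_{m,N})$, and put $\boldsymbol\nu(f)=(\langle\nu_1,f\rangle,\dots,\langle\nu_M,f\rangle)$.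 Let $E:\mathbb R^M\times\mathbb R^M\to[0,\infty]$ and fix $\boldsymbol y\in\mathbb R^M$ such that $E(\boldsymbol y,\cdot)$ is proper, lower semicontinuous and strictly convex on its effective domain. Let $\psi:[0,\infty)\to[0,\infty)$ be strictly increasing and strictly convex. Let $$S=\arg\min_{f\in X'}\big(E(\boldsymbol y,\boldsymbol\nu(f))+\psi(\|f\|_{X'})\big),$$ and let $S|_n=\{f_n: f\in S\}\subset X_n'$. *Conclusions.* $S$ is nonempty, convex and weak\*-compact. There are $a\in\mathbb R^M$ and $y^*\in\mathbb R^N$ such that every $f_0=(f_{0,1},\dots,f_{0,N})\in S$ is a Banach conjugate of $\nu_0=\sum_{m}a_m\nu_m$ and, with $y=(\|f_{0,1}\|,\dots,\|f_{0,N}\|)\in Z'$, the vector $y^*\in Z''=Z$ is a Banach conjugate of $y$. Put $\alpha_n=y_n/y_n^*$ if $y_n\ne0$ and $\alpha_n=0$ otherwise. 1. Suppose $Z'$ is strictly convex. Then, for every $f_0\in S$, $\alpha_n>0$ whenever $y_n\neq 0$, and: - if $X_n'$ is a Hilbert space, then $f_{0,n}$ is unique ($S|_n$ is a single point) and $f_{0,n}=\alpha_n\sum_m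 a_m\varphi_{m,n}$ with $\varphi_{m,n}=\mathrm J_{X_n}\{\nu_{m,n}\}$, where $\mathrm J_{X_n}$ is the Riesz map $X_n\to X_n'$; - if $X_n'$ is strictly convex, then $f_{0,n}$ is unique and $f_{0,n}=\alpha_n\,\mathrm J_{X_n}\{\sum_m a_m\nu_{m,n}\}$. 2. For every $n$ (in particular when $X_n'$ is not strictly convex), $S|_n$ is the weak\*-closure of the convex hull of its extreme points, and each of these is the $n$-th component of some $f_0\in\mathrm{Ext}(S)$. For every $f_0\in\mathrm{Ext}(S)$ let $K_0$ be the minimal number of points of $\mathrm{Ext}(B_{X'})$ of which $f_0$ is a linear combination. Then $K_0$ exists, $K_0\le M$, and for every $n$ one has $f_{0,n}=\sum_{k=1}^{K_0}c_{k,n}e_{k,n}$ with $c_{k,n}\in\mathbb R$ and $e_{k,n}\in\mathrm{Ext}(B_{X_n'})$. 3. Suppose $\|\cdot\|_{Z'}=\|\cdot\|_1$. Then for every $f_0\in\mathrm{Ext}(S)$ there are $K_1,\dots,K_N\ge 0$ with $\sum_nK_n\le M$ and $f_{0,n}=\sum_{k=1}^{K_n}c_{k,n}e_{k,n}$, where $c_{k,n}\in\mathbb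 R$ and $e_{k,n}\in\mathrm{Ext}(B_{X_n'})$; here, for each $n$ with $X_n'$ strictly convex and $f_{0,n}\ne0$, one has $K_n=1$, $c_{1,n}=\|f_{0,n}\|$ and $e_{1,n}=f_{0,n}/\|f_{0,n}\|$. Moreover, for every $f_0\in S$, $\alpha_n>0$ whenever $y_n\ne0$, and the formulas for $f_{0,n}$ in item 1 remain valid for Hilbert, respectively strictly convex, $X_n'$ (without uniqueness). -/

import Mathlib

open scoped NNReal ENNReal

/-! ### Duality mapping of a real normed space -/

/-- The duality mapping `J(x)`: all `f` in the dual with `‖f‖ = ‖x‖` and `⟨x, f⟩ = ‖x‖ ‖f‖`. -/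
def dualityMap {X : Type*} [NormedAddCommGroup X] [NormedSpace ℝ X] (x : X) :
    Set (StrongDual ℝ X) :=
  {f | ‖f‖ = ‖x‖ ∧ f x = ‖x‖ * ‖f‖}

/-- The duality mapping is single-valued and `J` is the resulting duality operator. -/
def IsDualityOperator {X : Type*} [NormedAddCommGroup X] [NormedSpace ℝ X]
    (J : X → StrongDual ℝ X) : Prop :=
  ∀ x, dualityMap x = {J x}

/-- The norm is induced by an inner product (together with completeness: a Hilbert space). -/
def HasHilbertNorm (H : Type*) [NormedAddCommGroup H] [NormedSpace ℝ H] : Prop :=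
  ∃ B : H →ₗ[ℝ] H →ₗ[ℝ] ℝ, (∀ x y, B x y = B y x) ∧ ∀ x, B x x = ‖x‖ ^ 2

/-- `R` is the Riesz map: `(x, y) ↦ R x y` is the inner product that induces the norm. -/
def IsRieszMap {X : Type*} [NormedAddCommGroup X] [NormedSpace ℝ X]
    (R : X →L[ℝ] StrongDual ℝ X) : Prop :=
  (∀ x y, R x y = R y x) ∧ ∀ x, R x x = ‖x‖ ^ 2

/-! ### Absolute norms on `ℝ^N` -/

/-- A norm on `ℝ^N` that depends only on the absolute values of the coordinates. -/
structure AbsoluteNorm (N : ℕ) extends Seminorm ℝ (Fin N → ℝ) where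
  definite : ∀ z, toFun z = 0 → z = 0
  absolute : ∀ z, toFun (fun n => |z n|) = toFun z

namespace AbsoluteNorm

variable {N : ℕ}

instance : CoeFun (AbsoluteNorm N) (fun _ => (Fin N → ℝ) → ℝ) := ⟨fun ρ => ρ.toSeminorm⟩

/-- The dual norm `‖y‖_{Z'} = sup { ∑ y_n z_n : ‖z‖_Z ≤ 1 }`. -/
noncomputable def dualNorm (ρ : AbsoluteNorm N) (y : Fin N → ℝ) : ℝ :=
  sSup {r | ∃ z : Fin N → ℝ, ρ z ≤ 1 ∧ r = ∑ n, y n * z n}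

/-- The duality mapping `J_{Z'}` from `Z'` to subsets of `Z'' = Z`. -/
def dualDualityMap (ρ : AbsoluteNorm N) (y : Fin N → ℝ) : Set (Fin N → ℝ) :=
  {z | ρ z = ρ.dualNorm y ∧ ∑ n, y n * z n = ρ.dualNorm y * ρ z}

/-- Strict convexity of the dual norm `‖·‖_{Z'}`. -/
def DualStrictConvex (ρ : AbsoluteNorm N) : Prop :=
  ∀ u v : Fin N → ℝ, ρ.dualNorm u = 1 → ρ.dualNorm v = 1 → u ≠ v →
    ∀ t : ℝ, 0 < t → t < 1 → ρ.dualNorm (t • u + (1 - t) • v) < 1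

/-- The dual norm `‖·‖_{Z'}` is the `ℓ¹` norm. -/
def DualIsL1 (ρ : AbsoluteNorm N) : Prop :=
  ∀ y : Fin N → ℝ, ρ.dualNorm y = ∑ n, |y n|

theorem update_le (ρ : AbsoluteNorm N) (z : Fin N → ℝ) (i : Fin N) (s : ℝ) (hs : |s| ≤ |z i|) :
    ρ (Function.update z i s) ≤ ρ z := by
  classical
  rcases eq_or_ne (z i) 0 with h0 | h0
  · have hs0 : s = z i := by
      rw [h0] at hs ⊢
      simpa using hs
    rw [hs0, Function.update_eq_self]
  · have hneg : ρ (Function.update z i (-(z i))) = ρ z := by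
      have habs : ∀ w : Fin N → ℝ, ρ (fun n => |w n|) = ρ w := ρ.absolute
      rw [← habs (Function.update z i (-(z i))), ← habs z]
      have : (fun n => |Function.update z i (-(z i)) n|) = fun n => |z n| := by
        funext n
        rcases eq_or_ne n i with rfl | hn
        · simp
        · simp [hn]
      rw [this]
    set t : ℝ := (1 + s / z i) / 2 with ht
    have hq : |s / z i| ≤ 1 := by
      rw [abs_div]
      exact div_le_one_of_le₀ hs (abs_nonneg _)
    have hq' := abs_le.mp hq
    have ht0 : 0 ≤ t := by rw [ht]; linarith
    have ht1 : 0 ≤ 1 - t := by rw [ht]; linarith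
    have hdec : Function.update z i s = t • z + (1 - t) • Function.update z i (-(z i)) := by
      funext n
      rcases eq_or_ne n i with rfl | hn
      · simp only [Function.update_self, Pi.add_apply, Pi.smul_apply, smul_eq_mul, ht]
        field_simp
        ring
      · simp only [Function.update_of_ne hn, Pi.add_apply, Pi.smul_apply, smul_eq_mul]
        ring
    calc ρ (Function.update z i s)
        = ρ (t • z + (1 - t) • Function.update z i (-(z i))) := by rw [hdec]
      _ ≤ ρ (t • z) + ρ ((1 - t) • Function.update z i (-(z i))) := map_add_le_add ρ.toSeminorm _ _
      _ = t * ρ z + (1 - t) * ρ z := by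
          rw [map_smul_eq_mul, map_smul_eq_mul, hneg, Real.norm_of_nonneg ht0,
            Real.norm_of_nonneg ht1]
      _ = ρ z := by ring

/-- An absolute norm is monotone. -/
theorem mono (ρ : AbsoluteNorm N) (u v : Fin N → ℝ) (h : ∀ n, |u n| ≤ |v n|) : ρ u ≤ ρ v := by
  classical
  have key : ∀ s : Finset (Fin N), ρ (fun n => if n ∈ s then u n else v n) ≤ ρ v := by
    intro s
    induction s using Finset.induction_on with
    | empty => simp
    | insert i s hi ih =>
      refine le_trans ?_ ih
      have : (fun n => if n ∈ insert i s then u n else v n)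
          = Function.update (fun n => if n ∈ s then u n else v n) i (u i) := by
        funext n
        rcases eq_or_ne n i with rfl | hn
        · simp
        · simp [hn]
      rw [this]
      apply ρ.update_le
      simpa [hi] using h i
  simpa using key Finset.univ

end AbsoluteNorm

/-! ### Direct products with a composite norm -/

/-- The direct product `(X_1 × ⋯ × X_N)_Z`, where `Z` is `ℝ^N` with the absolute norm `ρ`. -/
def DirectProd {N : ℕ} (_ρ : AbsoluteNorm N) (X : Fin N → Type*) := ∀ n, X n

namespace DirectProd

variable {N : ℕ} {ρ : AbsoluteNorm N} {X : Fin N → Type*}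
  [∀ n, NormedAddCommGroup (X n)]

instance : AddCommGroup (DirectProd ρ X) := inferInstanceAs (AddCommGroup (∀ n, X n))

instance [∀ n, NormedSpace ℝ (X n)] : Module ℝ (DirectProd ρ X) := inferInstanceAs (Module ℝ (∀ n, X n))

/-- The composite norm `‖(‖x_1‖, …, ‖x_N‖)‖_Z`. -/
noncomputable def compositeNorm (ρ : AbsoluteNorm N) (X : Fin N → Type*)
    [∀ n, NormedAddCommGroup (X n)] : AddGroupNorm (∀ n, X n) where
  toFun x := ρ (fun n => ‖x n‖)
  map_zero' := by
    have : (fun n => ‖(0 : ∀ n, X n) n‖) = (0 : Fin N → ℝ) := by funext n; simp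
    rw [this]
    exact map_zero ρ.toSeminorm
  add_le' x y := by
    refine le_trans (ρ.mono _ ((fun n => ‖x n‖) + fun n => ‖y n‖) fun n => ?_)
      (map_add_le_add ρ.toSeminorm _ _)
    rw [abs_of_nonneg (norm_nonneg _)]
    exact (norm_add_le _ _).trans (le_abs_self _)
  neg' x := by simp
  eq_zero_of_map_eq_zero' x hx := by
    have h := ρ.definite _ hx
    funext n
    simpa using congrFun h n

noncomputable instance : NormedAddCommGroup (DirectProd ρ X) :=
  AddGroupNorm.toNormedAddCommGroup (compositeNorm ρ X)

theorem norm_def (x : DirectProd ρ X) : ‖x‖ = ρ (fun n => ‖x n‖) := rfl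

variable [∀ n, NormedSpace ℝ (X n)]

noncomputable instance : NormedSpace ℝ (DirectProd ρ X) where
  norm_smul_le c x := by
    have h : (fun n => ‖(c • x) n‖) = ‖c‖ • fun n => ‖x n‖ := by
      funext n
      exact norm_smul c (x n)
    rw [norm_def, norm_def, h, map_smul_eq_mul, norm_norm]

/-- The inclusion of the `n`-th factor. -/
noncomputable def single (ρ : AbsoluteNorm N) (X : Fin N → Type*)
    [∀ n, NormedAddCommGroup (X n)] [∀ n, NormedSpace ℝ (X n)] (n : Fin N) :
    X n →L[ℝ] DirectProd ρ X :=
  LinearMap.mkContinuous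
    { toFun := fun x => (Pi.single n x : ∀ k, X k)
      map_add' := fun x y => Pi.single_add n x y
      map_smul' := fun c x => Pi.single_smul n c x }
    (ρ (Pi.single n 1)) (fun x => by
      have h : (fun k => ‖(Pi.single n x : ∀ k, X k) k‖) = ‖x‖ • (Pi.single n 1 : Fin N → ℝ) := by
        funext k
        rcases eq_or_ne k n with rfl | hk
        · simp
        · simp [hk]
      change ρ (fun k => ‖(Pi.single n x : ∀ k, X k) k‖) ≤ _
      rw [h, map_smul_eq_mul, norm_norm, mul_comm])

/-- The `n`-th component `f_n ∈ X_n'` of `f ∈ X'`, so that `⟨f, x⟩ = ∑ ⟨f_n, x_n⟩`. -/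
noncomputable def component (n : Fin N) (f : StrongDual ℝ (DirectProd ρ X)) :
    StrongDual ℝ (X n) :=
  f.comp (single ρ X n)

/-- The vector `(‖f_1‖, …, ‖f_N‖)` of component norms. -/
noncomputable def componentNorms (f : StrongDual ℝ (DirectProd ρ X)) : Fin N → ℝ :=
  fun n => ‖component n f‖

end DirectProd

/-! ### The optimization problem -/

/-- Strict convexity of an extended-valued function on its effective domain. Since the values are
in `[0, ∞]`, this includes convexity. -/
def EStrictConvex {M : ℕ} (F : (Fin M → ℝ) → ℝ≥0∞) : Prop :=
  ∀ u v : Fin M → ℝ, u ≠ v → F u ≠ ∞ → F v ≠ ∞ → ∀ t : ℝ, 0 < t → t < 1 →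
    F (t • u + (1 - t) • v) < ENNReal.ofReal t * F u + ENNReal.ofReal (1 - t) * F v

/-- The functional `f ↦ E(y, ν(f)) + ψ(‖f‖)` on the dual of `X`. -/
noncomputable def objective {M : ℕ} {X : Type*} [NormedAddCommGroup X] [NormedSpace ℝ X]
    (E : (Fin M → ℝ) → (Fin M → ℝ) → ℝ≥0∞) (y : Fin M → ℝ) (ν : Fin M → X) (ψ : ℝ≥0 → ℝ≥0)
    (f : StrongDual ℝ X) : ℝ≥0∞ :=
  E y (fun m => f (ν m)) + (ψ ‖f‖₊ : ℝ≥0∞)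

/-- The set of minimizers over the dual of `X`. -/
def solutionSet {M : ℕ} {X : Type*} [NormedAddCommGroup X] [NormedSpace ℝ X]
    (E : (Fin M → ℝ) → (Fin M → ℝ) → ℝ≥0∞) (y : Fin M → ℝ) (ν : Fin M → X) (ψ : ℝ≥0 → ℝ≥0) :
    Set (StrongDual ℝ X) :=
  {f | ∀ g, objective E y ν ψ f ≤ objective E y ν ψ g}

/-- The scaling constants `α_n = y_n / y*_n` if `y_n ≠ 0`, and `0` otherwise. -/
noncomputable def scaling {N : ℕ} (y ystar : Fin N → ℝ) (n : Fin N) : ℝ :=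
  open Classical in if y n = 0 then 0 else y n / ystar n

/-- The extremal points of the closed unit ball of the dual of `X`. -/
def dualAtoms (X : Type*) [NormedAddCommGroup X] [NormedSpace ℝ X] : Set (StrongDual ℝ X) :=
  Set.extremePoints ℝ (Metric.closedBall (0 : StrongDual ℝ X) 1)

/-- `f` is a linear combination of `K` extremal points of the unit ball of the dual of `X`. -/
def IsAtomicSum {X : Type*} [NormedAddCommGroup X] [NormedSpace ℝ X] (K : ℕ)
    (f : StrongDual ℝ X) : Prop :=
  ∃ (c : Fin K → ℝ) (e : Fin K → StrongDual ℝ X), (∀ k, e k ∈ dualAtoms X) ∧ f = ∑ k, c k • e k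

/-- The image of a subset of the dual in the dual with its weak* topology. -/
def weakStar {X : Type*} [NormedAddCommGroup X] [NormedSpace ℝ X] (A : Set (StrongDual ℝ X)) :
    Set (WeakDual ℝ X) :=
  StrongDual.toWeakDual '' A

/-!
Strict convexity forces all minimizers to share the measurement vector `z = ν(f)` and the norm, so
`S` consists of the functionals of minimal norm among those with `ν(f) = z`. By Hahn–Banach the
minimal norm is that of the restriction of `f` to `span ν`, where it is attained at some
`ν₀ = ∑ a_m ν_m`; hence `S` is the slice `ν(f) = z` of the set of Banach conjugates of `ν₀`. The
equality case of `⟨f, ν₀⟩ ≤ ‖f‖ ‖ν₀‖` then splits into equality in every component and in the outer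
space, which gives the formulas for the components.

The conjugates of `ν₀` form a face of the ball of radius `‖ν₀‖`. At an extreme point `f` of `S`, the
direction space of the smallest face of that ball containing `f` meets the kernel of `ν` only in
`0`, and `ν` maps it into the hyperplane orthogonal to `a`. Its dimension is therefore less than
`M`, and Carathéodory's theorem writes `f` in terms of at most `M` extreme points of the ball. The
nonzero components of an extreme point of the unit ball of `X'` are multiples of extreme points of
the unit balls of the factors, and for the outer `ℓ¹` norm there is only one such component.
-/

/-! ### The duality mapping -/

section DualityMap

variable {X : Type*} [NormedAddCommGroup X] [NormedSpace ℝ X]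

theorem dual_apply_le (f : StrongDual ℝ X) (x : X) : f x ≤ ‖f‖ * ‖x‖ :=
  (le_abs_self _).trans (f.le_opNorm x)

theorem exists_norm_le_one_lt_apply (f : StrongDual ℝ X) {r : ℝ} (hr : r < ‖f‖) :
    ∃ x, ‖x‖ ≤ 1 ∧ r < f x := by
  obtain ⟨x, hx, hrx⟩ := f.exists_lt_apply_of_lt_opNorm hr
  rcases lt_abs.1 (Real.norm_eq_abs (f x) ▸ hrx) with h | h
  · exact ⟨x, hx.le, h⟩
  · exact ⟨-x, (norm_neg x).trans_le hx.le, by rwa [map_neg]⟩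

theorem mem_dualityMap_of_sq_norm_add_sq_norm_le {f : StrongDual ℝ X} {x : X}
    (h : ‖f‖ ^ 2 + ‖x‖ ^ 2 ≤ 2 * f x) : f ∈ dualityMap x := by
  have hfx := dual_apply_le f x
  have hnorm : ‖f‖ = ‖x‖ := by
    rw [← sub_eq_zero, ← sq_eq_zero_iff]
    exact le_antisymm (by linarith) (sq_nonneg _)
  refine ⟨hnorm, ?_⟩
  rw [hnorm] at h hfx ⊢
  linarith

theorem mem_dualityMap_iff {f : StrongDual ℝ X} {x : X} :
    f ∈ dualityMap x ↔ ‖f‖ ≤ ‖x‖ ∧ f x = ‖x‖ ^ 2 := by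
  constructor
  · rintro ⟨hf, hfx⟩
    exact ⟨hf.le, by rw [hfx, hf, sq]⟩
  · rintro ⟨hf, hfx⟩
    refine mem_dualityMap_of_sq_norm_add_sq_norm_le ?_
    rw [hfx]
    linarith [pow_le_pow_left₀ (norm_nonneg f) hf 2]

theorem dualityMap_zero : dualityMap (0 : X) = {0} := by
  ext f
  simp [mem_dualityMap_iff]

theorem dualityMap_nonempty (x : X) : (dualityMap x).Nonempty := by
  obtain ⟨g, hg, hgx⟩ := exists_dual_vector'' ℝ x
  refine ⟨‖x‖ • g, mem_dualityMap_iff.2 ⟨?_, ?_⟩⟩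
  · rw [norm_smul, norm_norm]
    exact mul_le_of_le_one_right (norm_nonneg x) hg
  · rw [smul_apply, hgx, RCLike.ofReal_real_eq_id, id, smul_eq_mul, sq]

theorem dualityMap_eq_closedBall_inter (x : X) :
    dualityMap x = Metric.closedBall 0 ‖x‖ ∩ {f | f x = ‖x‖ ^ 2} := by
  ext f
  rw [mem_dualityMap_iff, Set.mem_inter_iff, mem_closedBall_zero_iff, Set.mem_ofPred_eq]

theorem convex_dualityMap (x : X) : Convex ℝ (dualityMap x) := by
  rw [dualityMap_eq_closedBall_inter]
  refine (convex_closedBall 0 ‖x‖).inter fun f hf g hg a b _ _ hab => ?_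
  rw [Set.mem_ofPred_eq] at *
  rw [add_apply, smul_apply, smul_apply, hf, hg, ← add_smul, hab, one_smul]

theorem isClosed_dualityMap (x : X) : IsClosed (dualityMap x) := by
  rw [dualityMap_eq_closedBall_inter]
  exact Metric.isClosed_closedBall.inter
    (isClosed_eq (ContinuousLinearMap.apply ℝ ℝ x).continuous continuous_const)

theorem isExtreme_closedBall_dualityMap (x : X) :
    IsExtreme ℝ (Metric.closedBall 0 ‖x‖) (dualityMap x) := by
  refine ⟨fun f hf => mem_closedBall_zero_iff.2 hf.1.le, ?_⟩
  rintro f hf g hg _ hmem ⟨a, b, ha, hb, hab, rfl⟩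
  rw [mem_closedBall_zero_iff] at hf hg
  have hfx := (dual_apply_le f x).trans (mul_le_mul_of_nonneg_right hf (norm_nonneg x))
  have hgx := (dual_apply_le g x).trans (mul_le_mul_of_nonneg_right hg (norm_nonneg x))
  have hsum : a * f x + b * g x = (a + b) * (‖x‖ * ‖x‖) := by
    rw [hab, one_mul, ← sq, ← (mem_dualityMap_iff.1 hmem).2]
    rfl
  refine mem_dualityMap_iff.2 ⟨hf, ?_⟩
  nlinarith

theorem dualityMap_subsingleton [StrictConvexSpace ℝ (StrongDual ℝ X)] (x : X) :
    (dualityMap x).Subsingleton := by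
  intro f hf g hg
  refine eq_of_norm_eq_of_norm_add_eq (hf.1.trans hg.1.symm) (le_antisymm (norm_add_le f g) ?_)
  have hmid := (convex_dualityMap x) hf hg (a := 1 / 2) (b := 1 / 2) (by norm_num) (by norm_num)
    (by norm_num)
  rw [← smul_add] at hmid
  have hnorm := hmid.1
  rw [norm_smul, Real.norm_of_nonneg (by norm_num)] at hnorm
  rw [hf.1, hg.1]
  linarith

theorem isDualityOperator_of_mem [StrictConvexSpace ℝ (StrongDual ℝ X)] {J : X → StrongDual ℝ X}
    (hJ : ∀ x, J x ∈ dualityMap x) : IsDualityOperator J := fun x =>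
  (dualityMap_subsingleton x).eq_singleton_of_mem (hJ x)

theorem exists_isDualityOperator [StrictConvexSpace ℝ (StrongDual ℝ X)] :
    ∃ J : X → StrongDual ℝ X, IsDualityOperator J :=
  ⟨fun x => (dualityMap_nonempty x).some,
    isDualityOperator_of_mem fun x => (dualityMap_nonempty x).some_mem⟩

theorem IsDualityOperator.eq_div_smul {J : X → StrongDual ℝ X} (hJ : IsDualityOperator J)
    {g : StrongDual ℝ X} {x : X} (hgx : g x = ‖g‖ * ‖x‖) (hx : x = 0 → g = 0) :
    g = (‖g‖ / ‖x‖) • J x := by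
  rcases eq_or_ne g 0 with rfl | hg
  · simp
  have hg' : ‖g‖ ≠ 0 := norm_ne_zero_iff.2 hg
  have hx' : ‖x‖ ≠ 0 := norm_ne_zero_iff.2 (mt hx hg)
  have hmem : (‖x‖ / ‖g‖) • g ∈ dualityMap x := by
    refine mem_dualityMap_iff.2 ⟨?_, ?_⟩
    · rw [norm_smul, norm_div, norm_norm, norm_norm, div_mul_cancel₀ _ hg']
    · rw [smul_apply, hgx, smul_eq_mul]
      field_simp
  rw [hJ x, Set.mem_singleton_iff] at hmem
  rw [← hmem, smul_smul, div_mul_div_cancel₀ hx', div_self hg', one_smul]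

end DualityMap

section HilbertDual

theorem HasHilbertNorm.innerProductSpaceable {H : Type*} [NormedAddCommGroup H] [NormedSpace ℝ H]
    (h : HasHilbertNorm H) : InnerProductSpaceable H := by
  obtain ⟨B, -, hB⟩ := h
  refine ⟨fun x y => ?_⟩
  simp only [← pow_two, ← hB, map_add, map_sub, LinearMap.add_apply, LinearMap.sub_apply]
  ring

theorem HasHilbertNorm.strictConvexSpace {H : Type*} [NormedAddCommGroup H] [NormedSpace ℝ H]
    (h : HasHilbertNorm H) : StrictConvexSpace ℝ H :=
  have := h.innerProductSpaceable
  inferInstance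

variable {X : Type*} [NormedAddCommGroup X] [NormedSpace ℝ X]

-- Young's inequality for conjugates of `x + y` and `x - y` gives one half of the identity; the
-- other half is the same inequality for the pair `(x + y, x - y)`.
theorem innerProductSpaceable_of_dual [InnerProductSpaceable (StrongDual ℝ X)] :
    InnerProductSpaceable X := by
  have key : ∀ x y : X, ‖x + y‖ * ‖x + y‖ + ‖x - y‖ * ‖x - y‖ ≤
      2 * (‖x‖ * ‖x‖ + ‖y‖ * ‖y‖) := by
    intro x y
    obtain ⟨f, hf⟩ := dualityMap_nonempty (x + y)
    obtain ⟨g, hg⟩ := dualityMap_nonempty (x - y)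
    have hparallel := InnerProductSpaceable.parallelogram_identity f g
    have hx := dual_apply_le (f + g) x
    have hy := dual_apply_le (f - g) y
    have hfx := (mem_dualityMap_iff.1 hf).2
    have hgx := (mem_dualityMap_iff.1 hg).2
    rw [hf.1, hg.1] at hparallel
    simp only [add_apply, sub_apply] at hx hy
    rw [map_add] at hfx
    rw [map_sub] at hgx
    nlinarith [sq_nonneg (‖f + g‖ - 2 * ‖x‖), sq_nonneg (‖f - g‖ - 2 * ‖y‖)]
  refine ⟨fun x y => le_antisymm (key x y) ?_⟩
  have h := key (x + y) (x - y)
  rw [add_add_sub_cancel, add_sub_sub_cancel, ← two_smul ℝ x, ← two_smul ℝ y, norm_smul, norm_smul,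
    Real.norm_ofNat] at h
  linarith

theorem exists_isRieszMap_of_hasHilbertNorm_dual (h : HasHilbertNorm (StrongDual ℝ X)) :
    ∃ R : X →L[ℝ] StrongDual ℝ X, IsRieszMap R ∧ IsDualityOperator R := by
  have := h.innerProductSpaceable
  have := h.strictConvexSpace
  have hX := innerProductSpaceable_of_dual (X := X)
  let : InnerProductSpace ℝ X := InnerProductSpace.ofNorm ℝ hX.parallelogram_identity
  let R : X →L[ℝ] StrongDual ℝ X := (innerₗ X).mkContinuous₂ 1 fun x y => by
    rw [one_mul]
    exact norm_inner_le_norm (𝕜 := ℝ) x y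
  have hR : ∀ x, R x = innerSL ℝ x := fun x => rfl
  refine ⟨R, ⟨fun x y => ?_, fun x => ?_⟩, isDualityOperator_of_mem fun x => ?_⟩
  · rw [hR, hR, innerSL_apply_apply, innerSL_apply_apply, real_inner_comm]
  · rw [hR, innerSL_apply_apply, real_inner_self_eq_norm_sq]
  · rw [hR, mem_dualityMap_iff, innerSL_apply_norm, innerSL_apply_apply,
      real_inner_self_eq_norm_sq]
    exact ⟨le_rfl, rfl⟩

end HilbertDual

/-! ### Finitely many measurements -/

section Measurement

variable {X : Type*} [NormedAddCommGroup X] [NormedSpace ℝ X] {ι : Type*}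

/-- The measurement map `f ↦ (⟨ν_m, f⟩)_m` from the dual of `X` to `ℝ^ι`, written `𝛎` in the
statement; it is bundled as a linear map in order to speak of its kernel and its fibres. -/
def measurement (ν : ι → X) : StrongDual ℝ X →ₗ[ℝ] ι → ℝ where
  toFun f m := f (ν m)
  map_add' _ _ := rfl
  map_smul' _ _ := rfl

theorem measurement_apply (ν : ι → X) (f : StrongDual ℝ X) (m : ι) :
    measurement ν f m = f (ν m) :=
  rfl

theorem apply_sum_smul_eq_sum_measurement [Fintype ι] (ν : ι → X) (a : ι → ℝ)
    (f : StrongDual ℝ X) : f (∑ m, a m • ν m) = ∑ m, a m * measurement ν f m := by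
  simp only [map_sum, map_smul, smul_eq_mul, measurement_apply]

theorem measurement_surjective [Finite ι] {ν : ι → X} (hν : LinearIndependent ℝ ν) :
    Function.Surjective (measurement ν) := by
  intro z
  have := Module.Finite.of_basis (Module.Basis.span hν)
  obtain ⟨f, hf, -⟩ := exists_extension_norm_eq _
    ((Module.Basis.span hν).constr ℝ z).toContinuousLinearMap
  refine ⟨f, funext fun m => ?_⟩
  have hm := hf (Module.Basis.span hν m)
  rwa [LinearMap.coe_toContinuousLinearMap', Module.Basis.constr_basis,
    Module.Basis.span_apply] at hm

theorem exists_mem_dualityMap_of_finiteDimensional {V : Type*} [NormedAddCommGroup V]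
    [NormedSpace ℝ V] [FiniteDimensional ℝ V] (φ : StrongDual ℝ V) : ∃ v, φ ∈ dualityMap v := by
  have := FiniteDimensional.proper_real V
  obtain ⟨w, hw, hφ⟩ := (isCompact_closedBall (0 : V) 1).exists_sSup_image_eq
    ⟨0, Metric.mem_closedBall_self zero_le_one⟩ φ.continuous.norm.continuousOn
  rw [φ.sSup_unitClosedBall_eq_norm] at hφ
  rw [mem_closedBall_zero_iff] at hw
  refine ⟨φ w • w, mem_dualityMap_of_sq_norm_add_sq_norm_le ?_⟩
  have hle : ‖φ w • w‖ ≤ ‖φ‖ := by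
    rw [norm_smul, ← hφ]
    exact mul_le_of_le_one_right (norm_nonneg _) hw
  have hsq : φ (φ w • w) = ‖φ‖ ^ 2 := by
    rw [map_smul, smul_eq_mul, ← sq, ← sq_abs, ← Real.norm_eq_abs, ← hφ]
  linarith [pow_le_pow_left₀ (norm_nonneg _) hle 2]

-- Restrict `f` to the span of the `ν_m`, where its norm is attained, and extend back to `X` by
-- Hahn–Banach.
theorem exists_mem_dualityMap_measurement_eq [Fintype ι] (ν : ι → X) (f : StrongDual ℝ X) :
    ∃ a : ι → ℝ, ∃ g ∈ dualityMap (∑ m, a m • ν m), measurement ν g = measurement ν f := by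
  let V := Submodule.span ℝ (Set.range ν)
  have : FiniteDimensional ℝ V := FiniteDimensional.span_of_finite ℝ (Set.finite_range ν)
  obtain ⟨v, hv⟩ := exists_mem_dualityMap_of_finiteDimensional (f.comp V.subtypeL)
  obtain ⟨g, hgf, hg⟩ := exists_extension_norm_eq V (f.comp V.subtypeL)
  obtain ⟨a, ha⟩ := (Submodule.mem_span_range_iff_exists_fun ℝ).1 v.2
  refine ⟨a, g, ?_, funext fun m => hgf ⟨ν m, Submodule.subset_span ⟨m, rfl⟩⟩⟩
  rw [ha, mem_dualityMap_iff, hg, hgf]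
  exact mem_dualityMap_iff.1 hv

end Measurement

/-! ### Faces of convex sets -/

section Faces

variable {V : Type*} [AddCommGroup V] [Module ℝ V] {C : Set V} {d f x y : V}

/-- The direction space of the smallest face of the convex set `C` that contains `x`. It is defined
as a span of symmetric perturbations; `mem_faceDirections_iff` shows that up to scaling all its
elements are of this kind. -/
def faceDirections (C : Set V) (x : V) : Submodule ℝ V :=
  Submodule.span ℝ {d | x + d ∈ C ∧ x - d ∈ C}

theorem mem_faceDirections_of_smul {ε : ℝ} (hε : ε ≠ 0) (hadd : x + ε • d ∈ C)
    (hsub : x - ε • d ∈ C) : d ∈ faceDirections C x :=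
  ((faceDirections C x).smul_mem_iff hε).1 (Submodule.subset_span ⟨hadd, hsub⟩)

theorem add_smul_add_mem (hC : Convex ℝ C) {u v : V} {δ ε : ℝ} (hδ : 0 < δ)
    (hε : 0 < ε) (hu : x + δ • u ∈ C) (hv : x + ε • v ∈ C) :
    x + (δ * ε / (δ + ε)) • (u + v) ∈ C := by
  have hsum : ε / (δ + ε) + δ / (δ + ε) = 1 := by field_simp; ring
  convert hC hu hv (by positivity) (by positivity) hsum using 1
  match_scalars <;> field_simp
  ring

theorem mem_faceDirections_iff (hC : Convex ℝ C) (hx : x ∈ C) :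
    d ∈ faceDirections C x ↔ ∃ ε : ℝ, 0 < ε ∧ x + ε • d ∈ C ∧ x - ε • d ∈ C := by
  refine ⟨fun hd => ?_, fun ⟨ε, hε, hadd, hsub⟩ => mem_faceDirections_of_smul hε.ne' hadd hsub⟩
  induction hd using Submodule.span_induction with
  | mem d hd => exact ⟨1, one_pos, by simpa only [one_smul, Set.mem_ofPred_eq] using hd⟩
  | zero => exact ⟨1, one_pos, by simpa using hx⟩
  | add u v _ _ hu hv =>
    obtain ⟨δ, hδ, hu₁, hu₂⟩ := hu
    obtain ⟨ε, hε, hv₁, hv₂⟩ := hv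
    refine ⟨δ * ε / (δ + ε), by positivity, add_smul_add_mem hC hδ hε hu₁ hv₁, ?_⟩
    rw [sub_eq_add_neg, ← smul_neg] at hu₂ hv₂ ⊢
    rw [neg_add]
    exact add_smul_add_mem hC hδ hε hu₂ hv₂
  | smul c u _ hu =>
    obtain ⟨ε, hε, hu⟩ := hu
    rcases lt_trichotomy c 0 with hc | rfl | hc
    · refine ⟨ε / -c, div_pos hε (neg_pos.2 hc), ?_⟩
      rw [smul_smul, div_neg, neg_mul, div_mul_cancel₀ _ hc.ne, neg_smul, sub_neg_eq_add,
        ← sub_eq_add_neg]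
      exact hu.symm
    · exact ⟨1, one_pos, by simpa using hx⟩
    · exact ⟨ε / c, div_pos hε hc, by rwa [smul_smul, div_mul_cancel₀ _ hc.ne']⟩

theorem faceDirections_le_of_mem_openSegment (hC : Convex ℝ C) (hy : y ∈ C)
    (hf : f ∈ openSegment ℝ x y) : faceDirections C x ≤ faceDirections C f := by
  obtain ⟨a, b, ha, hb, hab, rfl⟩ := hf
  refine Submodule.span_le.2 fun d hd => mem_faceDirections_of_smul ha.ne' ?_ ?_
  · convert hC hd.1 hy ha.le hb.le hab using 1
    module
  · convert hC hd.2 hy ha.le hb.le hab using 1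
    module

theorem sub_mem_faceDirections_of_mem_openSegment (hC : Convex ℝ C) (hx : x ∈ C) (hy : y ∈ C)
    (hf : f ∈ openSegment ℝ x y) : x - f ∈ faceDirections C f := by
  obtain ⟨a, b, ha, hb, hab, rfl⟩ := hf
  have hf : a • x + b • y ∈ C := hC hx hy ha.le hb.le hab
  have hxy : a • (x - (a • x + b • y)) = -(b • (y - (a • x + b • y))) := by
    obtain rfl := eq_sub_of_add_eq hab
    module
  refine mem_faceDirections_of_smul ha.ne' (hC.add_smul_sub_mem hf hx ⟨ha.le, by linarith⟩) ?_
  rw [hxy, sub_neg_eq_add]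
  exact hC.add_smul_sub_mem hf hy ⟨hb.le, by linarith⟩

theorem exists_mem_openSegment_of_sub_mem_faceDirections (hC : Convex ℝ C) (hf : f ∈ C)
    (hx : x - f ∈ faceDirections C f) : ∃ y ∈ C, f ∈ openSegment ℝ x y := by
  obtain ⟨ε, hε, -, hsub⟩ := (mem_faceDirections_iff hC hf).1 hx
  refine ⟨_, hsub, ε / (1 + ε), 1 / (1 + ε), by positivity, by positivity, by field_simp; ring, ?_⟩
  have : (1 + ε) ≠ 0 := by positivity
  match_scalars <;> field_simp <;> ring

theorem isExtreme_setOf_sub_mem_faceDirections (hC : Convex ℝ C) (hf : f ∈ C) :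
    IsExtreme ℝ C {x ∈ C | x - f ∈ faceDirections C f} := by
  refine ⟨Set.sep_subset _ _, fun x hx y hy z hz hzxy => ⟨hx, ?_⟩⟩
  obtain ⟨w, hw, hfzw⟩ := exists_mem_openSegment_of_sub_mem_faceDirections hC hf hz.2
  have hxz := faceDirections_le_of_mem_openSegment hC hw hfzw
    (sub_mem_faceDirections_of_mem_openSegment hC hx hy hzxy)
  simpa only [sub_add_sub_cancel] using add_mem hxz hz.2

theorem disjoint_faceDirections_ker_of_mem_extremePoints {W : Type*} [AddCommGroup W] [Module ℝ W]
    (hC : Convex ℝ C) (L : V →ₗ[ℝ] W) {w : W} (hf : f ∈ (C ∩ L ⁻¹' {w}).extremePoints ℝ) :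
    Disjoint (faceDirections C f) (LinearMap.ker L) := by
  refine Submodule.disjoint_def.2 fun d hd hLd => ?_
  obtain ⟨ε, hε, hadd, hsub⟩ := (mem_faceDirections_iff hC hf.1.1).1 hd
  have hLf : L f = w := hf.1.2
  have hmid : f ∈ openSegment ℝ (f + ε • d) (f - ε • d) :=
    ⟨1 / 2, 1 / 2, by norm_num, by norm_num, by norm_num, by module⟩
  have heq : f + ε • d = f :=
    hf.2 ⟨hadd, by simp [LinearMap.mem_ker.1 hLd, hLf]⟩
      ⟨hsub, by simp [LinearMap.mem_ker.1 hLd, hLf]⟩ hmid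
  simpa [hε.ne'] using heq

end Faces

section Caratheodory

variable {V : Type*} [NormedAddCommGroup V] [NormedSpace ℝ V] {C : Set V} {e f : V}

theorem exists_mem_extremePoints_sub_mem_faceDirections (hC : Convex ℝ C) (hclosed : IsClosed C)
    (hbdd : Bornology.IsBounded C) (hf : f ∈ C) [FiniteDimensional ℝ (faceDirections C f)] :
    ∃ e ∈ C.extremePoints ℝ, e - f ∈ faceDirections C f := by
  set D := faceDirections C f
  have := FiniteDimensional.proper_real D
  have hF : {x ∈ C | x - f ∈ D} = (fun d : D => f + d) '' ((fun d : D => f + (d : V)) ⁻¹' C) := by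
    ext x
    constructor
    · rintro ⟨hx, hxf⟩
      exact ⟨⟨x - f, hxf⟩, by simpa using hx, by simp⟩
    · rintro ⟨d, hd, rfl⟩
      exact ⟨hd, by simp⟩
  have hiso : Isometry (fun d : D => f + (d : V)) :=
    (isometry_add_left f).comp D.subtypeₗᵢ.isometry
  have hcompact : IsCompact {x ∈ C | x - f ∈ D} := by
    rw [hF]
    refine (Metric.isCompact_of_isClosed_isBounded (hclosed.preimage hiso.continuous) ?_).image
      hiso.continuous
    exact hiso.antilipschitz.isBounded_preimage hbdd
  obtain ⟨e, he⟩ := hcompact.extremePoints_nonempty ⟨f, hf, by simp⟩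
  exact ⟨e, (isExtreme_setOf_sub_mem_faceDirections hC hf).extremePoints_subset_extremePoints he,
    he.1.2⟩

-- Leave `e` through `f` until the boundary of `C` is hit at `g`: the direction `e - f` is lost.
theorem exists_mem_openSegment_faceDirections_lt (hC : Convex ℝ C) (hclosed : IsClosed C)
    (hbdd : Bornology.IsBounded C) (hf : f ∈ C) (he : e ∈ C) (hef : e - f ∈ faceDirections C f)
    (hne : e ≠ f) :
    ∃ g ∈ C, f ∈ openSegment ℝ e g ∧ faceDirections C g < faceDirections C f := by
  let ray : ℝ → V := AffineMap.lineMap e f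
  have hray : ∀ t δ : ℝ, ray (t + δ) = ray t - δ • (e - f) := fun t δ => by
    simp only [ray, AffineMap.lineMap_apply_module']
    module
  have hray_one : ray 1 = f := AffineMap.lineMap_apply_one e f
  have hone : 1 ∈ ray ⁻¹' C := by rwa [Set.mem_preimage, hray_one]
  have hcompact : IsCompact (ray ⁻¹' C) :=
    Metric.isCompact_of_isClosed_isBounded (hclosed.preimage AffineMap.lineMap_continuous)
      ((antilipschitzWith_lineMap hne).isBounded_preimage hbdd)
  obtain ⟨t, ht, hmax⟩ := hcompact.exists_isGreatest ⟨1, hone⟩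
  have ht_maximal : ∀ δ : ℝ, 0 < δ → ray t - δ • (e - f) ∉ C := fun δ hδ hmem => by
    rw [← hray] at hmem
    linarith [hmax hmem]
  have ht_one : 1 < t := by
    refine (hmax hone).lt_of_ne ?_
    rintro rfl
    obtain ⟨ε, hε, -, hsub⟩ := (mem_faceDirections_iff hC hf).1 hef
    exact ht_maximal ε hε (hray_one.symm ▸ hsub)
  have hopen : f ∈ openSegment ℝ (ray t) e := by
    refine ⟨1 / t, 1 - 1 / t, by positivity, by rw [sub_pos, div_lt_one] <;> linarith,
      add_sub_cancel _ _, ?_⟩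
    simp only [ray, AffineMap.lineMap_apply_module']
    match_scalars <;> field_simp
    ring
  refine ⟨ray t, ht, openSegment_symm ℝ (ray t) e ▸ hopen,
    (faceDirections_le_of_mem_openSegment hC he hopen).lt_of_not_ge fun hle => ?_⟩
  obtain ⟨δ, hδ, -, hsub⟩ := (mem_faceDirections_iff hC ht).1 (hle hef)
  exact ht_maximal δ hδ hsub

theorem exists_finset_extremePoints_mem_convexHull (hC : Convex ℝ C) (hclosed : IsClosed C)
    (hbdd : Bornology.IsBounded C) (hf : f ∈ C) [FiniteDimensional ℝ (faceDirections C f)] :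
    ∃ t : Finset V, ↑t ⊆ C.extremePoints ℝ ∧
      t.card ≤ Module.finrank ℝ (faceDirections C f) + 1 ∧ f ∈ convexHull ℝ (t : Set V) := by
  classical
  induction hn : Module.finrank ℝ (faceDirections C f) using Nat.strong_induction_on
    generalizing f with
  | _ n ih =>
  obtain ⟨e, he, hef⟩ := exists_mem_extremePoints_sub_mem_faceDirections hC hclosed hbdd hf
  rcases eq_or_ne e f with rfl | hne
  · exact ⟨{e}, by simpa using he, by simp, by simp⟩
  obtain ⟨g, hg, hfg, hlt⟩ :=
    exists_mem_openSegment_faceDirections_lt hC hclosed hbdd hf he.1 hef hne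
  have := Submodule.finiteDimensional_of_le hlt.le
  have hdim := hn ▸ Submodule.finrank_lt_finrank_of_lt hlt
  obtain ⟨t, ht, hcard, hgt⟩ := ih _ hdim hg rfl
  refine ⟨insert e t, ?_, (Finset.card_insert_le e t).trans (by omega), ?_⟩
  · rw [Finset.coe_insert]
    exact Set.insert_subset he ht
  · rw [Finset.coe_insert]
    exact (convex_convexHull ℝ _).openSegment_subset
      (subset_convexHull ℝ _ (Set.mem_insert e _))
      (convexHull_mono (Set.subset_insert e _) hgt) hfg

end Caratheodory

/-! ### Atomic sums -/

section AtomicSums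

open scoped Pointwise in
theorem inv_smul_mem_extremePoints_closedBall {V : Type*} [NormedAddCommGroup V] [NormedSpace ℝ V]
    {e : V} {r : ℝ} (hr : 0 < r) (he : e ∈ (Metric.closedBall (0 : V) r).extremePoints ℝ) :
    r⁻¹ • e ∈ (Metric.closedBall (0 : V) 1).extremePoints ℝ := by
  have h := Set.mem_image_of_mem (LinearEquiv.smulOfNeZero ℝ V r⁻¹ (inv_ne_zero hr.ne')) he
  rw [image_extremePoints] at h
  have hball : LinearEquiv.smulOfNeZero ℝ V r⁻¹ (inv_ne_zero hr.ne') '' Metric.closedBall 0 r =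
      Metric.closedBall 0 1 := by
    rw [← smul_unitClosedBall_of_nonneg hr.le]
    exact inv_smul_smul₀ hr.ne' (Metric.closedBall (0 : V) 1)
  rwa [hball] at h

theorem inv_norm_smul_eq_add_of_mem_extremePoints {V : Type*} [NormedAddCommGroup V]
    [NormedSpace ℝ V] {u v : V} (h : u + v ∈ (Metric.closedBall (0 : V) 1).extremePoints ℝ)
    (hu : u ≠ 0) (hle : ‖u‖ + ‖v‖ ≤ 1) : ‖u‖⁻¹ • u = u + v := by
  have hu_pos : 0 < ‖u‖ := norm_pos_iff.2 hu
  rcases (le_of_add_le_of_nonneg_left hle (norm_nonneg v)).eq_or_lt with hu_eq | hu_lt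
  · have hv : v = 0 := norm_le_zero_iff.1 (by linarith)
    rw [hu_eq, hv, inv_one, one_smul, add_zero]
  · have hs : 0 < 1 - ‖u‖ := sub_pos.2 hu_lt
    refine (mem_extremePoints_iff_left.1 h).2 _ ?_ ((1 - ‖u‖)⁻¹ • v) ?_
      ⟨‖u‖, 1 - ‖u‖, hu_pos, hs, add_sub_cancel _ _, ?_⟩
    · rw [mem_closedBall_zero_iff, norm_smul, norm_inv, norm_norm, inv_mul_cancel₀ hu_pos.ne']
    · rw [mem_closedBall_zero_iff, norm_smul, norm_inv, Real.norm_of_nonneg hs.le,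
        inv_mul_le_one₀ hs]
      linarith
    · rw [smul_inv_smul₀ hu_pos.ne', smul_inv_smul₀ hs.ne']

variable {X : Type*} [NormedAddCommGroup X] [NormedSpace ℝ X]

theorem inv_norm_smul_mem_dualAtoms [StrictConvexSpace ℝ (StrongDual ℝ X)] {g : StrongDual ℝ X}
    (hg : g ≠ 0) : ‖g‖⁻¹ • g ∈ dualAtoms X := by
  refine StrictConvexSpace.sphere_subset_extremePoints_closedBall _ one_ne_zero ?_
  rw [mem_sphere_zero_iff_norm, norm_smul, norm_inv, norm_norm,
    inv_mul_cancel₀ (norm_ne_zero_iff.2 hg)]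

theorem isAtomicSum_of_mem_span {t : Finset (StrongDual ℝ X)} {f : StrongDual ℝ X}
    (ht : ↑t ⊆ dualAtoms X) (hf : f ∈ Submodule.span ℝ (t : Set (StrongDual ℝ X))) :
    IsAtomicSum t.card f := by
  obtain ⟨c, -, rfl⟩ := Submodule.mem_span_finset.1 hf
  refine ⟨fun k => c (t.equivFin.symm k), fun k => t.equivFin.symm k,
    fun k => ht (t.equivFin.symm k).2, ?_⟩
  rw [t.equivFin.symm.sum_comp fun e : t => c e • (e : StrongDual ℝ X)]
  exact (t.sum_coe_sort fun e => c e • e).symm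

theorem exists_sum_dualAtoms_eq_of_mem_span {t : Finset (StrongDual ℝ X)} {f : StrongDual ℝ X}
    (ht : ↑t ⊆ dualAtoms X) (hf : f ∈ Submodule.span ℝ (t : Set (StrongDual ℝ X))) :
    ∃ (K : ℕ) (c : Fin K → ℝ) (e : Fin K → StrongDual ℝ X),
      K ≤ t.card ∧ (∀ k, e k ∈ dualAtoms X) ∧ f = ∑ k, c k • e k ∧
      (StrictConvexSpace ℝ (StrongDual ℝ X) → f ≠ 0 →
        K = 1 ∧ ∀ k, c k = ‖f‖ ∧ e k = ‖f‖⁻¹ • f) := by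
  by_cases h : StrictConvexSpace ℝ (StrongDual ℝ X) ∧ f ≠ 0
  · obtain ⟨_, hne⟩ := h
    refine ⟨1, fun _ => ‖f‖, fun _ => ‖f‖⁻¹ • f, ?_,
      fun _ => inv_norm_smul_mem_dualAtoms hne, ?_, fun _ _ => ⟨rfl, fun _ => ⟨rfl, rfl⟩⟩⟩
    · refine Finset.card_pos.2 (Finset.nonempty_iff_ne_empty.2 fun hempty => hne ?_)
      simpa [hempty] using hf
    · rw [Fin.sum_univ_one, smul_inv_smul₀ (norm_ne_zero_iff.2 hne)]
  · obtain ⟨c, e, he, hsum⟩ := isAtomicSum_of_mem_span ht hf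
    exact ⟨_, c, e, le_rfl, he, hsum, fun h₁ h₂ => absurd ⟨h₁, h₂⟩ h⟩

theorem IsAtomicSum.exists_finset {K : ℕ} {f : StrongDual ℝ X} (hf : IsAtomicSum K f) :
    ∃ t : Finset (StrongDual ℝ X), ↑t ⊆ dualAtoms X ∧ t.card ≤ K ∧
      f ∈ Submodule.span ℝ (t : Set (StrongDual ℝ X)) := by
  classical
  obtain ⟨c, e, he, rfl⟩ := hf
  refine ⟨Finset.univ.image e, by simpa [Set.range_subset_iff] using he,
    Finset.card_image_le.trans (Finset.card_fin K).le, sum_mem fun k _ => ?_⟩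
  exact Submodule.smul_mem _ _ (Submodule.subset_span (by simp))

theorem IsAtomicSum.exists_isLeast {K : ℕ} {f : StrongDual ℝ X} (hf : IsAtomicSum K f) :
    ∃ K₀ ≤ K, IsLeast {L | IsAtomicSum L f} K₀ :=
  ⟨sInf {L | IsAtomicSum L f}, Nat.sInf_le hf, Nat.sInf_mem ⟨K, hf⟩, fun _ => Nat.sInf_le⟩

variable {ι : Type*} [Fintype ι] {ν : ι → X} {a z : ι → ℝ} {f : StrongDual ℝ X}

theorem apply_eq_zero_of_mem_faceDirections_dualityMap {x : X} {d : StrongDual ℝ X}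
    (hf : f ∈ dualityMap x) (hd : d ∈ faceDirections (dualityMap x) f) : d x = 0 := by
  obtain ⟨ε, hε, hadd, -⟩ := (mem_faceDirections_iff (convex_dualityMap x) hf).1 hd
  have h := (mem_dualityMap_iff.1 hadd).2
  rw [add_apply, (mem_dualityMap_iff.1 hf).2, smul_apply, add_eq_left, smul_eq_zero] at h
  exact h.resolve_left hε.ne'

-- The measurement map is injective on the directions of the face of `f`, and its image is
-- orthogonal to `a ≠ 0`; this is what saves one dimension.
theorem finrank_faceDirections_dualityMap_lt (hx : ∑ m, a m • ν m ≠ 0)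
    (hf : f ∈ (dualityMap (∑ m, a m • ν m) ∩ measurement ν ⁻¹' {z}).extremePoints ℝ) :
    FiniteDimensional ℝ (faceDirections (dualityMap (∑ m, a m • ν m)) f) ∧
      Module.finrank ℝ (faceDirections (dualityMap (∑ m, a m • ν m)) f) < Fintype.card ι := by
  set D := faceDirections (dualityMap (∑ m, a m • ν m)) f
  have hinj : Function.Injective ((measurement ν).domRestrict D) := by
    rw [LinearMap.injective_domRestrict_iff]
    exact disjoint_faceDirections_ker_of_mem_extremePoints (convex_dualityMap _) _ hf
  have horth : ∀ d ∈ D, ∑ m, a m * measurement ν d m = 0 := fun d hd => by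
    rw [← apply_sum_smul_eq_sum_measurement]
    exact apply_eq_zero_of_mem_faceDirections_dualityMap hf.1.1 hd
  have hrange : LinearMap.range ((measurement ν).domRestrict D) ≠ ⊤ := by
    intro htop
    obtain ⟨d, hd⟩ := LinearMap.range_eq_top.1 htop a
    have haa : a ⬝ᵥ a = 0 := by
      have h := horth d d.2
      rwa [← LinearMap.domRestrict_apply, hd] at h
    rw [dotProduct_self_eq_zero.1 haa] at hx
    exact hx (by simp)
  refine ⟨FiniteDimensional.of_injective _ hinj, ?_⟩
  rw [← LinearMap.finrank_range_of_inj hinj, ← Module.finrank_fintype_fun_eq_card ℝ]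
  exact Submodule.finrank_lt hrange

theorem exists_isAtomicSum_of_mem_extremePoints
    (hf : f ∈ (dualityMap (∑ m, a m • ν m) ∩ measurement ν ⁻¹' {z}).extremePoints ℝ) :
    ∃ K ≤ Fintype.card ι, IsAtomicSum K f := by
  classical
  rcases eq_or_ne (∑ m, a m • ν m) 0 with hx | hx
  · rw [hx, dualityMap_zero] at hf
    exact ⟨0, Nat.zero_le _, 0, 0, fun k => k.elim0, by simpa using hf.1.1⟩
  obtain ⟨_, hdim⟩ := finrank_faceDirections_dualityMap_lt hx hf
  obtain ⟨t, ht, hcard, hft⟩ := exists_finset_extremePoints_mem_convexHull (convex_dualityMap _)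
    (isClosed_dualityMap _) (Metric.isBounded_closedBall.subset
      (isExtreme_closedBall_dualityMap _).subset) hf.1.1
  have hr : 0 < ‖∑ m, a m • ν m‖ := norm_pos_iff.2 hx
  set r := ‖∑ m, a m • ν m‖
  refine ⟨(t.image (r⁻¹ • ·)).card, Finset.card_image_le.trans (by omega),
    isAtomicSum_of_mem_span ?_ ?_⟩
  · rw [Finset.coe_image, Set.image_subset_iff]
    exact fun e he => inv_smul_mem_extremePoints_closedBall hr
      ((isExtreme_closedBall_dualityMap _).extremePoints_subset_extremePoints (ht he))
  · refine convexHull_min (fun e he => ?_) (Submodule.convex _) hft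
    have hmem : r⁻¹ • e ∈ ((t.image (r⁻¹ • ·) : Finset _) : Set (StrongDual ℝ X)) :=
      Finset.mem_coe.2 (Finset.mem_image_of_mem _ he)
    exact (Submodule.smul_mem_iff _ (inv_ne_zero hr.ne')).1 (Submodule.subset_span hmem)

end AtomicSums

/-! ### The weak* topology -/

section WeakStar

variable {X Y : Type*} [NormedAddCommGroup X] [NormedSpace ℝ X] [NormedAddCommGroup Y]
  [NormedSpace ℝ Y]

theorem locallyConvexSpace_weakDual : LocallyConvexSpace ℝ (WeakDual ℝ X) :=
  (WeakDual.withSeminorms ℝ X).toLocallyConvexSpace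

theorem weakStar_eq_preimage (A : Set (StrongDual ℝ X)) :
    weakStar A = WeakDual.toStrongDual ⁻¹' A :=
  LinearEquiv.image_eq_preimage_symm StrongDual.toWeakDual A

theorem extremePoints_weakStar (A : Set (StrongDual ℝ X)) :
    (weakStar A).extremePoints ℝ = weakStar (A.extremePoints ℝ) :=
  (image_extremePoints (𝕜 := ℝ) (StrongDual.toWeakDual (𝕜 := ℝ) (E := X)) A).symm

theorem convex_weakStar {A : Set (StrongDual ℝ X)} (hA : Convex ℝ A) : Convex ℝ (weakStar A) :=
  hA.linear_image (StrongDual.toWeakDual (𝕜 := ℝ) (E := X)).toLinearMap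

theorem weakStar_eq_closure_convexHull {A : Set (StrongDual ℝ X)} (hA : Convex ℝ A)
    (hcompact : IsCompact (weakStar A)) :
    weakStar A = closure (convexHull ℝ (weakStar (A.extremePoints ℝ))) := by
  have := locallyConvexSpace_weakDual (X := X)
  rw [← extremePoints_weakStar, closure_convexHull_extremePoints hcompact (convex_weakStar hA)]

theorem isCompact_weakStar_dualityMap_inter_fiber {ι : Type*} (ν : ι → X) (x : X) (z : ι → ℝ) :
    IsCompact (weakStar (dualityMap x ∩ measurement ν ⁻¹' {z})) := by
  have hfiber : IsClosed {f : WeakDual ℝ X | f x = ‖x‖ ^ 2 ∧ (fun m => f (ν m)) = z} :=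
    (isClosed_eq (WeakDual.eval_continuous x) continuous_const).inter
      (isClosed_eq (continuous_pi fun m => WeakDual.eval_continuous (ν m)) continuous_const)
  convert (WeakDual.isCompact_closedBall (𝕜 := ℝ) (0 : StrongDual ℝ X) ‖x‖).inter_right hfiber
    using 1
  rw [weakStar_eq_preimage, dualityMap_eq_closedBall_inter, Set.inter_assoc]
  ext f
  simp [funext_iff, measurement_apply]

/-- The restriction `f ↦ f ∘ A` of functionals along `A : Y → X`, bundled as a weak*-continuous
linear map. -/
noncomputable def weakDualRestrict (A : Y →L[ℝ] X) : WeakDual ℝ X →L[ℝ] WeakDual ℝ Y where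
  toFun f := StrongDual.toWeakDual ((WeakDual.toStrongDual f).comp A)
  map_add' _ _ := rfl
  map_smul' _ _ := rfl
  cont := WeakDual.continuous_of_continuous_eval fun x => WeakDual.eval_continuous (A x)

theorem weakStar_image_comp (A : Y →L[ℝ] X) (S : Set (StrongDual ℝ X)) :
    weakStar ((fun f => f.comp A) '' S) = weakDualRestrict A '' weakStar S := by
  rw [weakStar, weakStar, Set.image_image, Set.image_image]
  rfl

theorem isCompact_weakStar_image_comp (A : Y →L[ℝ] X) {S : Set (StrongDual ℝ X)}
    (hS : IsCompact (weakStar S)) : IsCompact (weakStar ((fun f => f.comp A) '' S)) := by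
  rw [weakStar_image_comp]
  exact hS.image (weakDualRestrict A).continuous

theorem convex_image_comp (A : Y →L[ℝ] X) {S : Set (StrongDual ℝ X)} (hS : Convex ℝ S) :
    Convex ℝ ((fun f => f.comp A) '' S) :=
  hS.linear_image (ContinuousLinearMap.precomp ℝ A).toLinearMap

theorem extremePoints_image_comp_subset (A : Y →L[ℝ] X) {S : Set (StrongDual ℝ X)}
    (hS : IsCompact (weakStar S)) :
    ((fun f => f.comp A) '' S).extremePoints ℝ ⊆ (fun f => f.comp A) '' S.extremePoints ℝ := by
  have := locallyConvexSpace_weakDual (X := X)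
  have h : weakStar (((fun f => f.comp A) '' S).extremePoints ℝ) ⊆
      weakStar ((fun f => f.comp A) '' S.extremePoints ℝ) := by
    rw [← extremePoints_weakStar, weakStar_image_comp, weakStar_image_comp,
      ← extremePoints_weakStar]
    exact surjOn_extremePoints_image (weakDualRestrict A).toContinuousAffineMap hS
  rwa [weakStar, weakStar, Set.image_subset_image_iff StrongDual.toWeakDual.injective] at h

theorem dualAtoms_nonempty : (dualAtoms X).Nonempty := by
  have := locallyConvexSpace_weakDual (X := X)
  have hcompact : IsCompact (weakStar (Metric.closedBall (0 : StrongDual ℝ X) 1)) := by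
    rw [weakStar_eq_preimage]
    exact WeakDual.isCompact_closedBall 0 1
  have hne := hcompact.extremePoints_nonempty
    ((Metric.nonempty_closedBall.2 zero_le_one).image StrongDual.toWeakDual)
  rwa [extremePoints_weakStar, weakStar, Set.image_nonempty] at hne

end WeakStar

/-! ### Minimizers of the regularized functional -/

section ConvexGrowth

variable {ψ : ℝ≥0 → ℝ≥0}

theorem convexOn_comp_toNNReal (hmono : Monotone ψ) (hψ : ConvexOn ℝ≥0 Set.univ ψ) :
    ConvexOn ℝ Set.univ fun t : ℝ => (ψ t.toNNReal : ℝ) := by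
  refine ⟨convex_univ, fun x _ y _ a b ha hb hab => ?_⟩
  lift a to ℝ≥0 using ha
  lift b to ℝ≥0 using hb
  have hsub : ((a : ℝ) • x + (b : ℝ) • y).toNNReal ≤ a • x.toNNReal + b • y.toNNReal := by
    rw [Real.toNNReal_le_iff_le_coe]
    push_cast [smul_eq_mul]
    gcongr <;> exact Real.le_coe_toNNReal _
  exact_mod_cast (hmono hsub).trans
    (hψ.2 (Set.mem_univ _) (Set.mem_univ _) zero_le zero_le (by exact_mod_cast hab))

theorem continuous_of_monotone_of_convexOn (hmono : Monotone ψ) (hψ : ConvexOn ℝ≥0 Set.univ ψ) :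
    Continuous ψ := by
  have hcont := (convexOn_comp_toNNReal hmono hψ).continuousOn_interior
  rw [interior_univ, continuousOn_univ] at hcont
  simpa only [NNReal.isEmbedding_coe.continuous_iff, Function.comp_def, Real.toNNReal_coe]
    using hcont.comp NNReal.continuous_coe

theorem exists_lt_of_strictMono_of_convexOn (hmono : StrictMono ψ)
    (hψ : ConvexOn ℝ≥0 Set.univ ψ) (c : ℝ≥0) : ∃ R, c < ψ R := by
  have hδ : (ψ 0 : ℝ) < ψ 1 := NNReal.coe_lt_coe.2 (hmono zero_lt_one)
  set δ : ℝ := ψ 1 - ψ 0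
  have hδ₀ : 0 < δ := sub_pos.2 hδ
  let R : ℝ := c / δ + 1
  have hR : 1 ≤ R := le_add_of_nonneg_left (by positivity)
  have hsecant : δ ≤ ((ψ R.toNNReal : ℝ) - ψ 0) / R := by
    simpa only [Real.toNNReal_zero, Real.toNNReal_one, sub_zero, div_one] using
      (convexOn_comp_toNNReal hmono.monotone hψ).secant_mono (Set.mem_univ 0)
        (Set.mem_univ 1) (Set.mem_univ R) one_ne_zero (by positivity) hR
  have hδR : δ * R = c + δ := by
    simp only [R]
    field_simp
  refine ⟨R.toNNReal, NNReal.coe_lt_coe.1 ?_⟩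
  rw [le_div_iff₀ (by positivity), hδR] at hsecant
  linarith [(ψ 0).coe_nonneg]

end ConvexGrowth

section Optimization

variable {M : ℕ} {X : Type*} [NormedAddCommGroup X] [NormedSpace ℝ X] {ν : Fin M → X}
  {E : (Fin M → ℝ) → (Fin M → ℝ) → ℝ≥0∞} {y : Fin M → ℝ} {ψ : ℝ≥0 → ℝ≥0} {f g : StrongDual ℝ X}

theorem lowerSemicontinuous_nnnorm_weakDual :
    LowerSemicontinuous fun f : WeakDual ℝ X => ‖WeakDual.toStrongDual f‖₊ := by
  refine lowerSemicontinuous_iff_isClosed_preimage.2 fun r => ?_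
  convert WeakDual.isClosed_closedBall (𝕜 := ℝ) (0 : StrongDual ℝ X) (r : ℝ) using 1
  ext f
  simp [← NNReal.coe_le_coe]

theorem lowerSemicontinuous_objective (hE_lsc : LowerSemicontinuous (E y))
    (hψ_mono : Monotone ψ) (hψ : ConvexOn ℝ≥0 Set.univ ψ) :
    LowerSemicontinuous fun f : WeakDual ℝ X => objective E y ν ψ (WeakDual.toStrongDual f) := by
  have hψ_cont := ENNReal.continuous_coe.comp (continuous_of_monotone_of_convexOn hψ_mono hψ)
  have heval : Continuous fun (f : WeakDual ℝ X) m => f (ν m) :=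
    continuous_pi fun m => WeakDual.eval_continuous (ν m)
  exact (hE_lsc.comp heval).add (hψ_cont.comp_lowerSemicontinuous
    lowerSemicontinuous_nnnorm_weakDual (ENNReal.coe_mono.comp hψ_mono))

theorem exists_norm_le_of_objective_le (hψ_mono : StrictMono ψ) (hψ : ConvexOn ℝ≥0 Set.univ ψ)
    {c : ℝ≥0∞} (hc : c ≠ ∞) :
    ∃ R : ℝ, ∀ f : StrongDual ℝ X, objective E y ν ψ f ≤ c → ‖f‖ ≤ R := by
  obtain ⟨R, hR⟩ := exists_lt_of_strictMono_of_convexOn hψ_mono hψ c.toNNReal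
  refine ⟨R, fun f hf => ?_⟩
  have hψf : (ψ ‖f‖₊ : ℝ≥0∞) ≤ c.toNNReal := by
    rw [ENNReal.coe_toNNReal hc]
    exact le_add_self.trans hf
  exact (hψ_mono.lt_iff_lt.1 ((ENNReal.coe_le_coe.1 hψf).trans_lt hR)).le

theorem solutionSet_nonempty (hE : ∃ f : StrongDual ℝ X, E y (fun m => f (ν m)) ≠ ∞)
    (hE_lsc : LowerSemicontinuous (E y)) (hψ_mono : StrictMono ψ)
    (hψ : ConvexOn ℝ≥0 Set.univ ψ) : (solutionSet E y ν ψ).Nonempty := by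
  obtain ⟨g, hg⟩ := hE
  obtain ⟨R, hR⟩ := exists_norm_le_of_objective_le (E := E) (y := y) (ν := ν) hψ_mono hψ
    (c := objective E y ν ψ g) (ENNReal.add_ne_top.2 ⟨hg, ENNReal.coe_ne_top⟩)
  have hmem {f : StrongDual ℝ X} (hf : objective E y ν ψ f ≤ objective E y ν ψ g) :
      StrongDual.toWeakDual f ∈ WeakDual.toStrongDual ⁻¹' Metric.closedBall 0 R :=
    mem_closedBall_zero_iff.2 (hR f hf)
  obtain ⟨f, -, hf⟩ := LowerSemicontinuousOn.exists_isMinOn ⟨_, hmem le_rfl⟩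
    (WeakDual.isCompact_closedBall (𝕜 := ℝ) 0 R)
    ((lowerSemicontinuous_objective (ν := ν) hE_lsc hψ_mono.monotone hψ).lowerSemicontinuousOn _)
  refine ⟨WeakDual.toStrongDual f, fun h => ?_⟩
  rcases le_total (objective E y ν ψ h) (objective E y ν ψ g) with hhg | hgh
  · exact hf (hmem hhg)
  · exact (hf (hmem le_rfl)).trans hgh

theorem ne_top_of_mem_solutionSet (hE : ∃ f : StrongDual ℝ X, E y (fun m => f (ν m)) ≠ ∞)
    (hf : f ∈ solutionSet E y ν ψ) : E y (measurement ν f) ≠ ∞ := by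
  obtain ⟨g, hg⟩ := hE
  exact ne_top_of_le_ne_top (ENNReal.add_ne_top.2 ⟨hg, ENNReal.coe_ne_top⟩)
    (le_self_add.trans (hf g))

theorem coe_comp_nnnorm_midpoint_le (hψ_mono : Monotone ψ) (hψ : ConvexOn ℝ≥0 Set.univ ψ)
    (f g : StrongDual ℝ X) :
    (ψ ‖(2⁻¹ : ℝ) • f + (2⁻¹ : ℝ) • g‖₊ : ℝ≥0∞) ≤ 2⁻¹ * ψ ‖f‖₊ + 2⁻¹ * ψ ‖g‖₊ := by
  have hnorm : ‖(2⁻¹ : ℝ) • f + (2⁻¹ : ℝ) • g‖₊ ≤ (2⁻¹ : ℝ≥0) • ‖f‖₊ + (2⁻¹ : ℝ≥0) • ‖g‖₊ := by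
    refine (nnnorm_add_le _ _).trans_eq ?_
    simp only [nnnorm_smul, nnnorm_inv, Real.nnnorm_ofNat, smul_eq_mul]
  have hconv := (hψ_mono hnorm).trans (hψ.2 (Set.mem_univ _) (Set.mem_univ _) zero_le zero_le
    (by rw [← two_mul, mul_inv_cancel₀ two_ne_zero]))
  have hcoe := ENNReal.coe_le_coe.2 hconv
  simpa using hcoe

theorem EStrictConvex.midpoint_lt {F : (Fin M → ℝ) → ℝ≥0∞} (hF : EStrictConvex F)
    {u v : Fin M → ℝ} (huv : u ≠ v) (hu : F u ≠ ∞) (hv : F v ≠ ∞) :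
    F ((2⁻¹ : ℝ) • u + (2⁻¹ : ℝ) • v) < 2⁻¹ * F u + 2⁻¹ * F v := by
  have hhalf : (1 - 2⁻¹ : ℝ) = 2⁻¹ := by norm_num
  have hcoe : ENNReal.ofReal 2⁻¹ = 2⁻¹ := by
    rw [ENNReal.ofReal_inv_of_pos two_pos, ENNReal.ofReal_ofNat]
  simpa only [hhalf, hcoe] using hF u v huv hu hv 2⁻¹ (by norm_num) (by norm_num)

theorem measurement_eq_of_mem_solutionSet
    (hE : ∃ f : StrongDual ℝ X, E y (fun m => f (ν m)) ≠ ∞) (hE_strict : EStrictConvex (E y))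
    (hψ_mono : Monotone ψ) (hψ : ConvexOn ℝ≥0 Set.univ ψ) (hf : f ∈ solutionSet E y ν ψ)
    (hg : g ∈ solutionSet E y ν ψ) : measurement ν f = measurement ν g := by
  by_contra hne
  have hlt := hE_strict.midpoint_lt hne (ne_top_of_mem_solutionSet hE hf)
    (ne_top_of_mem_solutionSet hE hg)
  rw [← map_smul, ← map_smul, ← map_add] at hlt
  have hvalue : objective E y ν ψ f = objective E y ν ψ g := le_antisymm (hf g) (hg f)
  refine (hf ((2⁻¹ : ℝ) • f + (2⁻¹ : ℝ) • g)).not_gt ?_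
  calc objective E y ν ψ ((2⁻¹ : ℝ) • f + (2⁻¹ : ℝ) • g)
      < (2⁻¹ * E y (measurement ν f) + 2⁻¹ * E y (measurement ν g)) +
          (2⁻¹ * ψ ‖f‖₊ + 2⁻¹ * ψ ‖g‖₊) :=
        ENNReal.add_lt_add_of_lt_of_le ENNReal.coe_ne_top hlt
          (coe_comp_nnnorm_midpoint_le hψ_mono hψ f g)
    _ = 2⁻¹ * objective E y ν ψ f + 2⁻¹ * objective E y ν ψ g := by
        rw [add_add_add_comm, ← mul_add, ← mul_add]
        rfl
    _ = objective E y ν ψ f := by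
        rw [← hvalue, ← add_mul, ENNReal.inv_two_add_inv_two, one_mul]

theorem objective_le_objective (hψ_mono : Monotone ψ)
    (hmeas : measurement ν f = measurement ν g) (hnorm : ‖f‖ ≤ ‖g‖) :
    objective E y ν ψ f ≤ objective E y ν ψ g :=
  add_le_add (congrArg (E y) hmeas).le (ENNReal.coe_le_coe.2 (hψ_mono hnorm))

theorem norm_eq_of_mem_solutionSet (hE : ∃ f : StrongDual ℝ X, E y (fun m => f (ν m)) ≠ ∞)
    (hψ_mono : StrictMono ψ) (hf : f ∈ solutionSet E y ν ψ) (hg : g ∈ solutionSet E y ν ψ)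
    (hmeas : measurement ν f = measurement ν g) : ‖f‖ = ‖g‖ := by
  have hvalue : E y (measurement ν f) + ψ ‖f‖₊ = E y (measurement ν f) + ψ ‖g‖₊ := by
    conv_rhs => rw [hmeas]
    exact le_antisymm (hf g) (hg f)
  rw [ENNReal.add_right_inj (ne_top_of_mem_solutionSet hE hf), ENNReal.coe_inj,
    hψ_mono.injective.eq_iff] at hvalue
  exact congrArg NNReal.toReal hvalue

theorem norm_le_of_mem_dualityMap_of_measurement_eq {ι : Type*} [Fintype ι] {ν : ι → X}
    {a : ι → ℝ} (hg : g ∈ dualityMap (∑ m, a m • ν m))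
    (hmeas : measurement ν g = measurement ν f) : ‖g‖ ≤ ‖f‖ := by
  have hle := dual_apply_le f (∑ m, a m • ν m)
  rw [apply_sum_smul_eq_sum_measurement, ← hmeas, ← apply_sum_smul_eq_sum_measurement, hg.2,
    ← hg.1, mul_comm ‖f‖] at hle
  rcases (norm_nonneg g).eq_or_lt with hzero | hpos
  · exact hzero ▸ norm_nonneg f
  · exact le_of_mul_le_mul_left hle hpos

theorem exists_solutionSet_eq (hE : ∃ f : StrongDual ℝ X, E y (fun m => f (ν m)) ≠ ∞)
    (hE_lsc : LowerSemicontinuous (E y)) (hE_strict : EStrictConvex (E y))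
    (hψ_mono : StrictMono ψ) (hψ : ConvexOn ℝ≥0 Set.univ ψ) :
    ∃ a z : Fin M → ℝ, (solutionSet E y ν ψ).Nonempty ∧
      solutionSet E y ν ψ = dualityMap (∑ m, a m • ν m) ∩ measurement ν ⁻¹' {z} := by
  obtain ⟨f₀, hf₀⟩ := solutionSet_nonempty hE hE_lsc hψ_mono hψ
  obtain ⟨a, g, hg, hgf₀⟩ := exists_mem_dualityMap_measurement_eq ν f₀
  have hsol {f : StrongDual ℝ X} (hf : measurement ν f = measurement ν f₀) (hnorm : ‖f‖ ≤ ‖f₀‖) :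
      f ∈ solutionSet E y ν ψ := fun h =>
    (objective_le_objective hψ_mono.monotone hf hnorm).trans (hf₀ h)
  have hgS := hsol hgf₀ (norm_le_of_mem_dualityMap_of_measurement_eq hg hgf₀)
  refine ⟨a, measurement ν f₀, ⟨f₀, hf₀⟩, Set.Subset.antisymm (fun f hf => ?_) ?_⟩
  · have hmeas := measurement_eq_of_mem_solutionSet hE hE_strict hψ_mono.monotone hψ hf hf₀
    have hnorm := norm_eq_of_mem_solutionSet hE hψ_mono hf hgS (hmeas.trans hgf₀.symm)
    refine ⟨⟨hnorm.trans hg.1, ?_⟩, hmeas⟩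
    rw [apply_sum_smul_eq_sum_measurement, hmeas, ← hgf₀, ← apply_sum_smul_eq_sum_measurement,
      hg.2, hnorm]
  · rintro f ⟨hf, hmeas⟩
    exact hsol hmeas (norm_le_of_mem_dualityMap_of_measurement_eq hf hmeas)

end Optimization

/-! ### Absolute norms and their duals -/

namespace AbsoluteNorm

variable {N : ℕ} {ρ : AbsoluteNorm N} {u v w : Fin N → ℝ}

theorem apply_single_pos (ρ : AbsoluteNorm N) (n : Fin N) : 0 < ρ (Pi.single n 1) :=
  (apply_nonneg ρ.toSeminorm _).lt_of_ne' fun h =>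
    one_ne_zero (Pi.single_eq_zero_iff.1 (ρ.definite _ h))

theorem abs_apply_le (ρ : AbsoluteNorm N) (z : Fin N → ℝ) (n : Fin N) :
    |z n| ≤ (ρ (Pi.single n 1))⁻¹ * ρ z := by
  have hle : ρ (z n • Pi.single n 1) ≤ ρ z := ρ.mono _ _ fun k => by
    rcases eq_or_ne k n with rfl | hk
    · simp
    · simp [hk]
  rw [map_smul_eq_mul, Real.norm_eq_abs] at hle
  rwa [← div_eq_inv_mul, le_div_iff₀ (ρ.apply_single_pos n)]

theorem bddAbove_dualNorm (ρ : AbsoluteNorm N) (y : Fin N → ℝ) :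
    BddAbove {r | ∃ z : Fin N → ℝ, ρ z ≤ 1 ∧ r = ∑ n, y n * z n} := by
  refine ⟨∑ n, |y n| * (ρ (Pi.single n 1))⁻¹, ?_⟩
  rintro _ ⟨z, hz, rfl⟩
  refine Finset.sum_le_sum fun n _ => (le_abs_self _).trans ?_
  rw [abs_mul]
  gcongr
  exact (ρ.abs_apply_le z n).trans
    (mul_le_of_le_one_right (inv_nonneg.2 (ρ.apply_single_pos n).le) hz)

theorem dualNorm_le {c : ℝ} (h : ∀ z, ρ z ≤ 1 → ∑ n, u n * z n ≤ c) : ρ.dualNorm u ≤ c := by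
  refine csSup_le ⟨_, 0, ?_, rfl⟩ ?_
  · rw [map_zero]
    exact zero_le_one
  · rintro _ ⟨z, hz, rfl⟩
    exact h z hz

theorem dualNorm_nonneg (ρ : AbsoluteNorm N) (y : Fin N → ℝ) : 0 ≤ ρ.dualNorm y :=
  le_csSup (ρ.bddAbove_dualNorm y) ⟨0, by rw [map_zero]; exact zero_le_one, by simp⟩

theorem sum_mul_le (ρ : AbsoluteNorm N) (y z : Fin N → ℝ) :
    ∑ n, y n * z n ≤ ρ.dualNorm y * ρ z := by
  rcases (apply_nonneg ρ.toSeminorm z).eq_or_lt with hzero | hpos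
  · rw [ρ.definite z hzero.symm, map_zero]
    simp
  · have hunit : ρ ((ρ z)⁻¹ • z) ≤ 1 := by
      rw [map_smul_eq_mul, norm_inv, Real.norm_of_nonneg hpos.le, inv_mul_cancel₀ hpos.ne']
    have hle : y ⬝ᵥ ((ρ z)⁻¹ • z) ≤ ρ.dualNorm y :=
      le_csSup (ρ.bddAbove_dualNorm y) ⟨_, hunit, rfl⟩
    rwa [dotProduct_smul, smul_eq_mul, inv_mul_le_iff₀ hpos, mul_comm] at hle

theorem sum_abs_mul_abs_le (ρ : AbsoluteNorm N) (y z : Fin N → ℝ) :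
    ∑ n, |y n| * |z n| ≤ ρ.dualNorm y * ρ z := by
  have hsign (n : Fin N) : |y n| * |z n| = y n * (SignType.sign (y n) * |z n|) := by
    rw [← mul_assoc, self_mul_sign]
  calc ∑ n, |y n| * |z n|
      = ∑ n, y n * (SignType.sign (y n) * |z n|) := Finset.sum_congr rfl fun n _ => hsign n
    _ ≤ ρ.dualNorm y * ρ fun n => SignType.sign (y n) * |z n| := ρ.sum_mul_le y _
    _ ≤ ρ.dualNorm y * ρ z := by
        refine mul_le_mul_of_nonneg_left (ρ.mono _ _ fun n => ?_) (ρ.dualNorm_nonneg y)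
        rcases lt_trichotomy (y n) 0 with h | h | h <;> simp [h]

theorem dualNorm_mono (ρ : AbsoluteNorm N) (h : ∀ n, |u n| ≤ |v n|) :
    ρ.dualNorm u ≤ ρ.dualNorm v := by
  refine dualNorm_le fun z hz => ?_
  calc ∑ n, u n * z n
      ≤ ∑ n, |v n| * |z n| := Finset.sum_le_sum fun n _ => by
        refine (le_abs_self _).trans ?_
        rw [abs_mul]
        exact mul_le_mul_of_nonneg_right (h n) (abs_nonneg _)
    _ ≤ ρ.dualNorm v * ρ z := ρ.sum_abs_mul_abs_le v z
    _ ≤ ρ.dualNorm v := mul_le_of_le_one_right (ρ.dualNorm_nonneg v) hz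

theorem dualNorm_smul_le (ρ : AbsoluteNorm N) {t : ℝ} (ht : 0 ≤ t) (y : Fin N → ℝ) :
    ρ.dualNorm (t • y) ≤ t * ρ.dualNorm y := by
  refine dualNorm_le fun z hz => ?_
  change t • y ⬝ᵥ z ≤ _
  rw [smul_dotProduct, smul_eq_mul]
  gcongr
  exact (ρ.sum_mul_le y z).trans (mul_le_of_le_one_right (ρ.dualNorm_nonneg y) hz)

theorem dualNorm_inv_smul_self (hu : 0 < ρ.dualNorm u) :
    ρ.dualNorm ((ρ.dualNorm u)⁻¹ • u) = 1 := by
  apply le_antisymm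
  · simpa only [inv_mul_cancel₀ hu.ne'] using ρ.dualNorm_smul_le (inv_nonneg.2 hu.le) u
  · have hle := ρ.dualNorm_smul_le hu.le ((ρ.dualNorm u)⁻¹ • u)
    rw [smul_inv_smul₀ hu.ne'] at hle
    exact (le_mul_iff_one_le_right hu).1 hle

theorem eq_zero_of_dualNorm_eq_zero (hu : ρ.dualNorm u = 0) : u = 0 := by
  have hle : u ⬝ᵥ u ≤ ρ.dualNorm u * ρ u := ρ.sum_mul_le u u
  rw [hu, zero_mul] at hle
  exact dotProduct_self_eq_zero.1 (hle.antisymm (Finset.sum_nonneg fun n _ => mul_self_nonneg _))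

theorem DualStrictConvex.eq_of_mem_dualDualityMap (hρ : ρ.DualStrictConvex)
    (hu : w ∈ ρ.dualDualityMap u) (hv : w ∈ ρ.dualDualityMap v) : u = v := by
  have huv : ρ.dualNorm u = ρ.dualNorm v := hu.1.symm.trans hv.1
  rcases (ρ.dualNorm_nonneg u).eq_or_lt' with hzero | hpos
  · rw [eq_zero_of_dualNorm_eq_zero hzero, eq_zero_of_dualNorm_eq_zero (huv.symm.trans hzero)]
  set r := ρ.dualNorm u with hr
  by_contra hne
  have hlt := hρ (r⁻¹ • u) (r⁻¹ • v) (dualNorm_inv_smul_self hpos)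
    (by rw [huv]; exact dualNorm_inv_smul_self (huv ▸ hpos))
    (fun h => hne (smul_right_injective _ (inv_ne_zero hpos.ne') h)) 2⁻¹ (by norm_num)
    (by norm_num)
  have huw : u ⬝ᵥ w = r * r := hu.2.trans (by rw [hu.1])
  have hvw : v ⬝ᵥ w = r * r := hv.2.trans (by rw [hv.1, ← huv])
  have hle : ((2⁻¹ : ℝ) • r⁻¹ • u + (1 - 2⁻¹ : ℝ) • r⁻¹ • v) ⬝ᵥ w ≤ _ * ρ w := ρ.sum_mul_le _ _
  simp only [add_dotProduct, smul_dotProduct, smul_eq_mul, huw, hvw, hu.1, ← hr,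
    inv_mul_cancel_left₀ hpos.ne'] at hle
  rw [← add_mul, add_sub_cancel] at hle
  exact (le_of_mul_le_mul_right hle hpos).not_gt hlt

theorem mem_dualDualityMap_update_zero (hw : w ∈ ρ.dualDualityMap u) {n : Fin N} (hwn : w n = 0) :
    w ∈ ρ.dualDualityMap (Function.update u n 0) := by
  have hsum : ∑ k, Function.update u n 0 k * w k = ∑ k, u k * w k :=
    Finset.sum_congr rfl fun k _ => by
      rcases eq_or_ne k n with rfl | hk
      · simp [hwn]
      · simp [hk]
  have hle : ρ.dualNorm (Function.update u n 0) ≤ ρ.dualNorm u := ρ.dualNorm_mono fun k => by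
    rcases eq_or_ne k n with rfl | hk
    · simp
    · simp [hk]
  have hge := ρ.sum_mul_le (Function.update u n 0) w
  rw [hsum, hw.2, hw.1] at hge
  have heq : ρ.dualNorm (Function.update u n 0) = ρ.dualNorm u := by
    rcases (ρ.dualNorm_nonneg u).eq_or_lt with hzero | hpos
    · exact hle.antisymm (hzero ▸ ρ.dualNorm_nonneg _)
    · exact hle.antisymm (le_of_mul_le_mul_right hge hpos)
  exact ⟨by rw [heq, hw.1], by rw [hsum, heq, hw.2]⟩

theorem apply_eq_zero_of_mem_dualDualityMap (hρ : ρ.DualStrictConvex ∨ ρ.DualIsL1)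
    (hw : w ∈ ρ.dualDualityMap u) {n : Fin N} (hwn : w n = 0) : u n = 0 := by
  have hmem := mem_dualDualityMap_update_zero hw hwn
  rcases hρ with hstrict | hL1
  · rw [hstrict.eq_of_mem_dualDualityMap hw hmem, Function.update_self]
  · have heq : ∑ k, |Function.update u n 0 k| = ∑ k, |u k| := by
      rw [← hL1, ← hL1, ← hmem.1, hw.1]
    have hle (k : Fin N) : |Function.update u n 0 k| ≤ |u k| := by
      rcases eq_or_ne k n with rfl | hk
      · simp
      · simp [hk]
    have hn := (Finset.sum_eq_sum_iff_of_le fun k _ => hle k).1 heq n (Finset.mem_univ n)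
    rwa [Function.update_self, abs_zero, eq_comm, abs_eq_zero] at hn

end AbsoluteNorm

theorem scaling_eq_div {N : ℕ} (y ystar : Fin N → ℝ) (n : Fin N) :
    scaling y ystar n = y n / ystar n := by
  rw [scaling]
  split_ifs with h
  · rw [h, zero_div]
  · rfl

/-! ### The dual of a direct product -/

namespace DirectProd

variable {N : ℕ} {ρ : AbsoluteNorm N} {X : Fin N → Type*}
  [∀ n, NormedAddCommGroup (X n)] [∀ n, NormedSpace ℝ (X n)]

theorem component_add (n : Fin N) (f g : StrongDual ℝ (DirectProd ρ X)) :
    component n (f + g) = component n f + component n g :=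
  rfl

theorem component_sub (n : Fin N) (f g : StrongDual ℝ (DirectProd ρ X)) :
    component n (f - g) = component n f - component n g :=
  rfl

theorem component_smul (n : Fin N) (c : ℝ) (f : StrongDual ℝ (DirectProd ρ X)) :
    component n (c • f) = c • component n f :=
  rfl

theorem component_sum {ι : Type*} (n : Fin N) (s : Finset ι)
    (f : ι → StrongDual ℝ (DirectProd ρ X)) :
    component n (∑ i ∈ s, f i) = ∑ i ∈ s, component n (f i) :=
  map_sum (AddMonoidHom.mk' (component n) (component_add n)) f s

theorem apply_eq_sum_component (f : StrongDual ℝ (DirectProd ρ X)) (x : DirectProd ρ X) :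
    f x = ∑ n, component n f (x n) := by
  have hx : ∑ n, single ρ X n (x n) = x := Finset.univ_sum_single (M := X) x
  conv_lhs => rw [← hx, map_sum]
  rfl

theorem ext_component {f g : StrongDual ℝ (DirectProd ρ X)}
    (h : ∀ n, component n f = component n g) : f = g := by
  ext x
  simp only [apply_eq_sum_component, h]

/-- The projection to the `n`-th factor. -/
noncomputable def proj (ρ : AbsoluteNorm N) (X : Fin N → Type*)
    [∀ n, NormedAddCommGroup (X n)] [∀ n, NormedSpace ℝ (X n)] (n : Fin N) :
    DirectProd ρ X →L[ℝ] X n :=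
  LinearMap.mkContinuous
    { toFun := fun x => x n
      map_add' := fun _ _ => rfl
      map_smul' := fun _ _ => rfl }
    (ρ (Pi.single n 1))⁻¹ fun x => (le_abs_self _).trans (ρ.abs_apply_le (fun k => ‖x k‖) n)

theorem proj_apply (n : Fin N) (x : DirectProd ρ X) : proj ρ X n x = x n :=
  rfl

theorem component_comp_proj_self (n : Fin N) (φ : StrongDual ℝ (X n)) :
    component n (φ.comp (proj ρ X n)) = φ := by
  ext x
  exact congrArg φ (Pi.single_eq_same n x)

theorem component_comp_proj_of_ne {k n : Fin N} (hkn : k ≠ n) (φ : StrongDual ℝ (X n)) :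
    component k (φ.comp (proj ρ X n)) = 0 := by
  ext x
  exact (congrArg φ (Pi.single_eq_of_ne' hkn x)).trans (map_zero φ)

theorem bijective_component :
    Function.Bijective
      (fun (f : StrongDual ℝ (DirectProd ρ X)) (n : Fin N) => component n f) := by
  refine ⟨fun f g h => ext_component (congrFun h),
    fun φ => ⟨∑ k, (φ k).comp (proj ρ X k), funext fun n => ?_⟩⟩
  change component n _ = _
  rw [component_sum, Finset.sum_eq_single_of_mem n (Finset.mem_univ n), component_comp_proj_self]
  exact fun k _ hkn => component_comp_proj_of_ne hkn.symm (φ k)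

theorem norm_le_dualNorm (f : StrongDual ℝ (DirectProd ρ X)) :
    ‖f‖ ≤ ρ.dualNorm (componentNorms f) := by
  refine f.opNorm_le_bound (ρ.dualNorm_nonneg _) fun x => ?_
  rw [apply_eq_sum_component, norm_def]
  calc ‖∑ n, component n f (x n)‖
      ≤ ∑ n, ‖component n f‖ * ‖x n‖ :=
        norm_sum_le_of_le _ fun n _ => (component n f).le_opNorm (x n)
    _ ≤ ρ.dualNorm (componentNorms f) * ρ fun n => ‖x n‖ := ρ.sum_mul_le (componentNorms f) _

theorem sum_sub_mul_abs_le_norm (f : StrongDual ℝ (DirectProd ρ X)) {z : Fin N → ℝ}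
    (hz : ρ z ≤ 1) {ε : ℝ} (hε : 0 < ε) : ∑ n, (‖component n f‖ - ε) * |z n| ≤ ‖f‖ := by
  choose x hx hxf using fun n =>
    exists_norm_le_one_lt_apply (component n f) (sub_lt_self ‖component n f‖ hε)
  let w : DirectProd ρ X := fun n => |z n| • x n
  have hw : ‖w‖ ≤ 1 := (ρ.mono _ z fun n => by
    rw [abs_norm, norm_smul, Real.norm_eq_abs, abs_abs]
    exact mul_le_of_le_one_right (abs_nonneg _) (hx n)).trans hz
  calc ∑ n, (‖component n f‖ - ε) * |z n|
      ≤ ∑ n, component n f (w n) := Finset.sum_le_sum fun n _ => by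
        rw [map_smul, smul_eq_mul, mul_comm]
        exact mul_le_mul_of_nonneg_left (hxf n).le (abs_nonneg _)
    _ = f w := (apply_eq_sum_component f w).symm
    _ ≤ ‖f‖ := (dual_apply_le f w).trans (mul_le_of_le_one_right (norm_nonneg f) hw)

open Filter Topology in
theorem norm_eq_dualNorm (f : StrongDual ℝ (DirectProd ρ X)) :
    ‖f‖ = ρ.dualNorm (componentNorms f) := by
  refine (norm_le_dualNorm f).antisymm (AbsoluteNorm.dualNorm_le fun z hz => ?_)
  have hlim : Tendsto (fun ε : ℝ => ∑ n, (‖component n f‖ - ε) * |z n|) (𝓝[>] 0)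
      (𝓝 (∑ n, ‖component n f‖ * |z n|)) :=
    (Continuous.tendsto' (by fun_prop) 0 _ (by simp only [sub_zero])).mono_left
      nhdsWithin_le_nhds
  refine le_trans ?_ (le_of_tendsto hlim <| eventually_mem_nhdsWithin.mono fun ε hε =>
    sum_sub_mul_abs_le_norm f hz hε)
  exact Finset.sum_le_sum fun n _ =>
    mul_le_mul_of_nonneg_left (le_abs_self _) (norm_nonneg (component n f))

theorem norm_le_of_norm_component_le {f g : StrongDual ℝ (DirectProd ρ X)}
    (h : ∀ n, ‖component n f‖ ≤ ‖component n g‖) : ‖f‖ ≤ ‖g‖ := by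
  rw [norm_eq_dualNorm, norm_eq_dualNorm]
  refine ρ.dualNorm_mono fun n => ?_
  simpa only [componentNorms, abs_norm] using h n

theorem norm_eq_sum_norm_component (hρ : ρ.DualIsL1) (f : StrongDual ℝ (DirectProd ρ X)) :
    ‖f‖ = ∑ n, ‖component n f‖ := by
  rw [norm_eq_dualNorm, hρ]
  simp only [componentNorms, abs_norm]

/-! ### Conjugates in a direct product -/

theorem sum_smul_apply {ι : Type*} [Fintype ι] (a : ι → ℝ) (ν : ι → DirectProd ρ X) (n : Fin N) :
    (∑ m, a m • ν m) n = ∑ m, a m • ν m n := by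
  simp only [← proj_apply, map_sum, map_smul]

section Conjugates

variable {f g : StrongDual ℝ (DirectProd ρ X)} {x : DirectProd ρ X}

theorem sum_componentNorms_mul_norm (hf : f ∈ dualityMap x) :
    ∑ n, componentNorms f n * ‖x n‖ = ‖f‖ * ‖x‖ := by
  apply le_antisymm
  · rw [norm_eq_dualNorm]
    exact ρ.sum_mul_le (componentNorms f) _
  · rw [mul_comm, ← hf.2, apply_eq_sum_component]
    exact Finset.sum_le_sum fun n _ => dual_apply_le (component n f) (x n)

theorem norms_mem_dualDualityMap (hf : f ∈ dualityMap x) :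
    (fun n => ‖x n‖) ∈ ρ.dualDualityMap (componentNorms f) := by
  refine ⟨?_, ?_⟩
  · rw [← norm_def, ← hf.1, norm_eq_dualNorm]
  · rw [sum_componentNorms_mul_norm hf, norm_eq_dualNorm, norm_def]

theorem component_apply_eq_norm_mul_norm (hf : f ∈ dualityMap x) (n : Fin N) :
    component n f (x n) = ‖component n f‖ * ‖x n‖ := by
  have heq : ∑ k, component k f (x k) = ∑ k, ‖component k f‖ * ‖x k‖ := by
    rw [← apply_eq_sum_component, hf.2, mul_comm]
    exact (sum_componentNorms_mul_norm hf).symm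
  exact (Finset.sum_eq_sum_iff_of_le fun k _ => dual_apply_le (component k f) (x k)).1 heq n
    (Finset.mem_univ n)

theorem component_eq_zero_of_apply_eq_zero (hρ : ρ.DualStrictConvex ∨ ρ.DualIsL1)
    (hf : f ∈ dualityMap x) {n : Fin N} (hx : x n = 0) : component n f = 0 :=
  norm_eq_zero.1 (AbsoluteNorm.apply_eq_zero_of_mem_dualDualityMap hρ
    (norms_mem_dualDualityMap hf) (norm_eq_zero.2 hx))

theorem scaling_pos (hρ : ρ.DualStrictConvex ∨ ρ.DualIsL1) (hf : f ∈ dualityMap x) {n : Fin N}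
    (hn : componentNorms f n ≠ 0) : 0 < scaling (componentNorms f) (fun k => ‖x k‖) n := by
  rw [scaling_eq_div]
  refine div_pos ((norm_nonneg _).lt_of_ne' hn) (norm_pos_iff.2 fun hx => hn ?_)
  exact norm_eq_zero.2 (component_eq_zero_of_apply_eq_zero hρ hf hx)

theorem component_eq_scaling_smul (hρ : ρ.DualStrictConvex ∨ ρ.DualIsL1) (hf : f ∈ dualityMap x)
    {n : Fin N} {J : X n → StrongDual ℝ (X n)} (hJ : IsDualityOperator J) :
    component n f = scaling (componentNorms f) (fun k => ‖x k‖) n • J (x n) := by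
  rw [scaling_eq_div]
  exact hJ.eq_div_smul (component_apply_eq_norm_mul_norm hf n)
    (component_eq_zero_of_apply_eq_zero hρ hf)

theorem component_eq_of_mem_dualityMap (hρ : ρ.DualStrictConvex) {n : Fin N}
    [StrictConvexSpace ℝ (StrongDual ℝ (X n))] (hf : f ∈ dualityMap x) (hg : g ∈ dualityMap x) :
    component n f = component n g := by
  obtain ⟨J, hJ⟩ := exists_isDualityOperator (X := X n)
  have hnorms : componentNorms f = componentNorms g :=
    hρ.eq_of_mem_dualDualityMap (norms_mem_dualDualityMap hf) (norms_mem_dualDualityMap hg)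
  rw [component_eq_scaling_smul (.inl hρ) hf hJ, component_eq_scaling_smul (.inl hρ) hg hJ, hnorms]

end Conjugates

section Solutions

variable {ι : Type*} [Fintype ι] {a : ι → ℝ} {ν : ι → DirectProd ρ X}
  {S : Set (StrongDual ℝ (DirectProd ρ X))}

theorem exists_isRieszMap_component_eq (hρ : ρ.DualStrictConvex ∨ ρ.DualIsL1)
    (hS : S ⊆ dualityMap (∑ m, a m • ν m)) {n : Fin N}
    (hn : HasHilbertNorm (StrongDual ℝ (X n))) :
    ∃ R : X n →L[ℝ] StrongDual ℝ (X n), IsRieszMap R ∧ IsDualityOperator R ∧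
      ∀ f ∈ S, component n f =
        scaling (componentNorms f) (fun k => ‖(∑ m, a m • ν m) k‖) n • ∑ m, a m • R (ν m n) := by
  obtain ⟨R, hR, hRJ⟩ := exists_isRieszMap_of_hasHilbertNorm_dual hn
  refine ⟨R, hR, hRJ, fun f hf => ?_⟩
  rw [component_eq_scaling_smul hρ (hS hf) hRJ, sum_smul_apply, map_sum]
  simp only [map_smul]

theorem exists_isDualityOperator_component_eq (hρ : ρ.DualStrictConvex ∨ ρ.DualIsL1)
    (hS : S ⊆ dualityMap (∑ m, a m • ν m)) {n : Fin N}
    [StrictConvexSpace ℝ (StrongDual ℝ (X n))] :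
    ∃ J : X n → StrongDual ℝ (X n), IsDualityOperator J ∧
      ∀ f ∈ S, component n f =
        scaling (componentNorms f) (fun k => ‖(∑ m, a m • ν m) k‖) n •
          J (∑ m, a m • ν m n) := by
  obtain ⟨J, hJ⟩ := exists_isDualityOperator (X := X n)
  refine ⟨J, hJ, fun f hf => ?_⟩
  rw [← sum_smul_apply]
  exact component_eq_scaling_smul hρ (hS hf) hJ

theorem exists_image_component_eq_singleton (hρ : ρ.DualStrictConvex) {x : DirectProd ρ X}
    (hS : S ⊆ dualityMap x) (hne : S.Nonempty) {n : Fin N}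
    (hn : HasHilbertNorm (StrongDual ℝ (X n)) ∨ StrictConvexSpace ℝ (StrongDual ℝ (X n))) :
    ∃ g, component n '' S = {g} := by
  have := hn.elim HasHilbertNorm.strictConvexSpace id
  obtain ⟨f, hf⟩ := hne
  refine ⟨component n f, (Set.Nonempty.image _ ⟨f, hf⟩).subset_singleton_iff.1 ?_⟩
  rintro _ ⟨g, hg, rfl⟩
  exact component_eq_of_mem_dualityMap hρ (hS hg) (hS hf)

end Solutions

/-! ### Atoms of a direct product -/

theorem norm_component_comp_proj_add_le {e : StrongDual ℝ (DirectProd ρ X)} {n : Fin N}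
    {φ : StrongDual ℝ (X n)} (hφ : ‖φ‖ ≤ ‖component n e‖) :
    ‖e + (φ - component n e).comp (proj ρ X n)‖ ≤ ‖e‖ := by
  refine norm_le_of_norm_component_le fun k => ?_
  rw [component_add]
  rcases eq_or_ne k n with rfl | hk
  · rwa [component_comp_proj_self, add_sub_cancel]
  · rw [component_comp_proj_of_ne hk, add_zero]

theorem component_mem_extremePoints_closedBall {e : StrongDual ℝ (DirectProd ρ X)}
    (he : e ∈ dualAtoms (DirectProd ρ X)) (n : Fin N) :
    component n e ∈ (Metric.closedBall 0 ‖component n e‖).extremePoints ℝ := by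
  obtain ⟨he_ball, he_ext⟩ := mem_extremePoints_iff_left.1 he
  let G (φ : StrongDual ℝ (X n)) := e + (φ - component n e).comp (proj ρ X n)
  have hG {φ : StrongDual ℝ (X n)} (hφ : φ ∈ Metric.closedBall 0 ‖component n e‖) :
      G φ ∈ Metric.closedBall 0 1 := by
    rw [mem_closedBall_zero_iff] at he_ball hφ ⊢
    exact (norm_component_comp_proj_add_le hφ).trans he_ball
  refine mem_extremePoints_iff_left.2 ⟨mem_closedBall_zero_iff.2 le_rfl, ?_⟩
  rintro φ₁ hφ₁ φ₂ hφ₂ ⟨a, b, ha, hb, hab, hcomb⟩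
  have hmid : a • G φ₁ + b • G φ₂ = e := by
    have hzero : a • (φ₁ - component n e) + b • (φ₂ - component n e) = 0 := by
      rw [smul_sub, smul_sub, sub_add_sub_comm, hcomb, ← add_smul, hab, one_smul, sub_self]
    calc a • G φ₁ + b • G φ₂
        = (a + b) • e +
            (a • (φ₁ - component n e) + b • (φ₂ - component n e)).comp (proj ρ X n) := by
          ext x
          simp only [G, add_apply, smul_apply, ContinuousLinearMap.comp_apply, smul_eq_mul]
          ring
      _ = e := by rw [hab, one_smul, hzero, ContinuousLinearMap.zero_comp, add_zero]
  have heq : G φ₁ = e := he_ext _ (hG hφ₁) _ (hG hφ₂) ⟨a, b, ha, hb, hab, hmid⟩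
  rw [← sub_eq_zero, ← component_comp_proj_self (ρ := ρ) n (φ₁ - component n e),
    add_eq_left.1 heq]
  rfl

theorem inv_norm_smul_component_mem_dualAtoms {e : StrongDual ℝ (DirectProd ρ X)}
    (he : e ∈ dualAtoms (DirectProd ρ X)) {n : Fin N} (hn : component n e ≠ 0) :
    ‖component n e‖⁻¹ • component n e ∈ dualAtoms (X n) :=
  inv_smul_mem_extremePoints_closedBall (norm_pos_iff.2 hn)
    (component_mem_extremePoints_closedBall he n)

theorem exists_smul_dualAtoms_eq_component {e : StrongDual ℝ (DirectProd ρ X)}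
    (he : e ∈ dualAtoms (DirectProd ρ X)) (n : Fin N) :
    ∃ b : ℝ, ∃ g ∈ dualAtoms (X n), component n e = b • g := by
  by_cases hn : component n e = 0
  · obtain ⟨g, hg⟩ := dualAtoms_nonempty (X := X n)
    exact ⟨0, g, hg, by rw [hn, zero_smul]⟩
  · exact ⟨_, _, inv_norm_smul_component_mem_dualAtoms he hn,
      (smul_inv_smul₀ (norm_ne_zero_iff.2 hn) _).symm⟩

theorem isAtomicSum_component {K : ℕ} {f : StrongDual ℝ (DirectProd ρ X)} (hf : IsAtomicSum K f)
    (n : Fin N) : IsAtomicSum K (component n f) := by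
  obtain ⟨c, e, he, rfl⟩ := hf
  choose b g hg hbg using fun k => exists_smul_dualAtoms_eq_component (he k) n
  refine ⟨fun k => c k * b k, g, hg, ?_⟩
  simp only [component_sum, component_smul, hbg, smul_smul]

theorem norm_comp_proj_add_norm_sub (hρ : ρ.DualIsL1) (e : StrongDual ℝ (DirectProd ρ X))
    (n : Fin N) :
    ‖(component n e).comp (proj ρ X n)‖ + ‖e - (component n e).comp (proj ρ X n)‖ = ‖e‖ := by
  rw [norm_eq_sum_norm_component hρ, norm_eq_sum_norm_component hρ,
    norm_eq_sum_norm_component hρ, ← Finset.sum_add_distrib]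
  refine Finset.sum_congr rfl fun k _ => ?_
  rw [component_sub]
  rcases eq_or_ne k n with rfl | hk
  · rw [component_comp_proj_self, sub_self, norm_zero, add_zero]
  · rw [component_comp_proj_of_ne hk, sub_zero, norm_zero, zero_add]

theorem eq_of_component_ne_zero (hρ : ρ.DualIsL1) {e : StrongDual ℝ (DirectProd ρ X)}
    (he : e ∈ dualAtoms (DirectProd ρ X)) {n k : Fin N} (hn : component n e ≠ 0)
    (hk : component k e ≠ 0) : n = k := by
  by_contra hnk
  let u := (component n e).comp (proj ρ X n)
  have hu : u ≠ 0 := fun h => hn <| by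
    rw [← component_comp_proj_self (ρ := ρ) n (component n e)]
    exact congrArg (component n) h
  have hue : ‖u‖⁻¹ • u = e := by
    have h := inv_norm_smul_eq_add_of_mem_extremePoints (v := e - u)
      (by rwa [add_sub_cancel]) hu
      ((norm_comp_proj_add_norm_sub hρ e n).trans_le (mem_closedBall_zero_iff.1 he.1))
    rwa [add_sub_cancel] at h
  apply hk
  rw [← hue, component_smul, component_comp_proj_of_ne (Ne.symm hnk), smul_zero]

section NormalizedComponents

open Classical in
/-- The normalizations of the nonzero `n`-th components of the elements of `t`; they are atoms of
the factor `X n` if `t` consists of atoms of the product. -/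
noncomputable def normalizedComponents (n : Fin N) (t : Finset (StrongDual ℝ (DirectProd ρ X))) :
    Finset (StrongDual ℝ (X n)) :=
  (t.filter (component n · ≠ 0)).image fun e => ‖component n e‖⁻¹ • component n e

variable {f : StrongDual ℝ (DirectProd ρ X)} {t : Finset (StrongDual ℝ (DirectProd ρ X))}

theorem normalizedComponents_subset_dualAtoms (ht : ↑t ⊆ dualAtoms (DirectProd ρ X))
    (n : Fin N) : ↑(normalizedComponents n t) ⊆ dualAtoms (X n) := by
  classical
  rw [normalizedComponents, Finset.coe_image, Set.image_subset_iff]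
  exact fun e he => inv_norm_smul_component_mem_dualAtoms (ht (Finset.mem_filter.1 he).1)
    (Finset.mem_filter.1 he).2

theorem component_mem_span_normalizedComponents
    (hf : f ∈ Submodule.span ℝ (t : Set (StrongDual ℝ (DirectProd ρ X)))) (n : Fin N) :
    component n f ∈
      Submodule.span ℝ (normalizedComponents n t : Set (StrongDual ℝ (X n))) := by
  classical
  obtain ⟨c, -, rfl⟩ := Submodule.mem_span_finset.1 hf
  rw [component_sum]
  refine sum_mem fun e he => ?_
  rw [component_smul]
  refine Submodule.smul_mem _ _ ?_
  by_cases hn : component n e = 0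
  · rw [hn]
    exact zero_mem _
  · rw [← smul_inv_smul₀ (norm_ne_zero_iff.2 hn) (component n e)]
    exact Submodule.smul_mem _ _ (Submodule.subset_span
      (Finset.mem_image_of_mem _ (Finset.mem_filter.2 ⟨he, hn⟩)))

theorem sum_card_normalizedComponents_le (hρ : ρ.DualIsL1)
    (ht : ↑t ⊆ dualAtoms (DirectProd ρ X)) : ∑ n, (normalizedComponents n t).card ≤ t.card := by
  classical
  refine (Finset.sum_le_sum fun n _ => Finset.card_image_le).trans ?_
  rw [← Finset.card_biUnion]
  · exact Finset.card_le_card (Finset.biUnion_subset.2 fun n _ => Finset.filter_subset _ t)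
  · refine fun n _ k _ hnk => Finset.disjoint_left.2 fun e hen hek => hnk ?_
    exact eq_of_component_ne_zero hρ (ht (Finset.mem_filter.1 hen).1) (Finset.mem_filter.1 hen).2
      (Finset.mem_filter.1 hek).2

theorem exists_sum_dualAtoms_eq_component (hρ : ρ.DualIsL1) {L : ℕ} (hf : IsAtomicSum L f) :
    ∃ (K : Fin N → ℕ) (c : ∀ n, Fin (K n) → ℝ) (e : ∀ n, Fin (K n) → StrongDual ℝ (X n)),
      ∑ n, K n ≤ L ∧
      ∀ n, (∀ k, e n k ∈ dualAtoms (X n)) ∧ component n f = ∑ k, c n k • e n k ∧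
        (StrictConvexSpace ℝ (StrongDual ℝ (X n)) → component n f ≠ 0 →
          K n = 1 ∧ ∀ k, c n k = ‖component n f‖ ∧
            e n k = ‖component n f‖⁻¹ • component n f) := by
  obtain ⟨t, ht, htL, hft⟩ := hf.exists_finset
  choose K c e hK h using fun n => exists_sum_dualAtoms_eq_of_mem_span
    (normalizedComponents_subset_dualAtoms ht n) (component_mem_span_normalizedComponents hft n)
  exact ⟨K, c, e, ((Finset.sum_le_sum fun n _ => hK n).trans
    (sum_card_normalizedComponents_le hρ ht)).trans htL, h⟩

end NormalizedComponents

end DirectProd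

/-! ### The representer theorem -/

theorem theorem2_general {M N : ℕ} (X : Fin N → Type*) [∀ n, NormedAddCommGroup (X n)]
    [∀ n, NormedSpace ℝ (X n)] (ρ : AbsoluteNorm N)
    (ν : Fin M → DirectProd ρ X)
    (E : (Fin M → ℝ) → (Fin M → ℝ) → ℝ≥0∞) (y : Fin M → ℝ)
    (hE_proper : ∃ f : StrongDual ℝ (DirectProd ρ X), E y (fun m => f (ν m)) ≠ ∞)
    (hE_lsc : LowerSemicontinuous (E y))
    (hE_strict : EStrictConvex (E y))
    (ψ : ℝ≥0 → ℝ≥0) (hψ_mono : StrictMono ψ) (hψ_convex : ConvexOn ℝ≥0 Set.univ ψ)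
    (S : Set (StrongDual ℝ (DirectProd ρ X))) (hS : S = solutionSet E y ν ψ) :
    (Function.Bijective
        (fun (f : StrongDual ℝ (DirectProd ρ X)) (n : Fin N) => DirectProd.component n f) ∧
      ∀ f : StrongDual ℝ (DirectProd ρ X), ‖f‖ = ρ.dualNorm (DirectProd.componentNorms f)) ∧
    (S.Nonempty ∧ Convex ℝ S ∧ IsCompact (weakStar S)) ∧
    (∃ (a : Fin M → ℝ) (ystar : Fin N → ℝ),
      (∀ f ∈ S, f ∈ dualityMap (∑ m, a m • ν m)) ∧
      (∀ f ∈ S, ystar ∈ ρ.dualDualityMap (DirectProd.componentNorms f)) ∧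
      (ρ.DualStrictConvex ∨ ρ.DualIsL1 →
        (∀ f ∈ S, ∀ n, DirectProd.componentNorms f n ≠ 0 →
          0 < scaling (DirectProd.componentNorms f) ystar n) ∧
        (∀ n, HasHilbertNorm (StrongDual ℝ (X n)) →
          ∃ R : X n →L[ℝ] StrongDual ℝ (X n), IsRieszMap R ∧ IsDualityOperator R ∧
            ∀ f ∈ S, DirectProd.component n f =
              scaling (DirectProd.componentNorms f) ystar n • ∑ m, a m • R (ν m n)) ∧
        (∀ n, StrictConvexSpace ℝ (StrongDual ℝ (X n)) →
          ∃ J : X n → StrongDual ℝ (X n), IsDualityOperator J ∧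
            ∀ f ∈ S, DirectProd.component n f =
              scaling (DirectProd.componentNorms f) ystar n • J (∑ m, a m • ν m n)))) ∧
    (ρ.DualStrictConvex →
      ∀ n, HasHilbertNorm (StrongDual ℝ (X n)) ∨ StrictConvexSpace ℝ (StrongDual ℝ (X n)) →
        ∃ g, DirectProd.component n '' S = {g}) ∧
    (∀ n,
      weakStar (DirectProd.component n '' S) =
        closure (convexHull ℝ (weakStar (Set.extremePoints ℝ (DirectProd.component n '' S)))) ∧
      Set.extremePoints ℝ (DirectProd.component n '' S) ⊆
        DirectProd.component n '' Set.extremePoints ℝ S) ∧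
    (∀ f ∈ Set.extremePoints ℝ S, ∃ K₀ ≤ M, IsLeast {K | IsAtomicSum K f} K₀ ∧
      ∀ n, IsAtomicSum K₀ (DirectProd.component n f)) ∧
    (ρ.DualIsL1 → ∀ f ∈ Set.extremePoints ℝ S,
      ∃ (K : Fin N → ℕ) (c : ∀ n, Fin (K n) → ℝ) (e : ∀ n, Fin (K n) → StrongDual ℝ (X n)),
        ∑ n, K n ≤ M ∧
        ∀ n, (∀ k, e n k ∈ dualAtoms (X n)) ∧
          DirectProd.component n f = ∑ k, c n k • e n k ∧
          (StrictConvexSpace ℝ (StrongDual ℝ (X n)) → DirectProd.component n f ≠ 0 →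
            K n = 1 ∧ ∀ k, c n k = ‖DirectProd.component n f‖ ∧
              e n k = ‖DirectProd.component n f‖⁻¹ • DirectProd.component n f)) := by
  obtain ⟨a, z, hne, hset⟩ := exists_solutionSet_eq hE_proper hE_lsc hE_strict hψ_mono hψ_convex
  rw [← hS] at hne hset
  have hconj : S ⊆ dualityMap (∑ m, a m • ν m) := hset ▸ Set.inter_subset_left
  have hconvex : Convex ℝ S :=
    hset ▸ (convex_dualityMap _).inter ((convex_singleton z).linear_preimage (measurement ν))
  have hcompact : IsCompact (weakStar S) :=
    hset ▸ isCompact_weakStar_dualityMap_inter_fiber ν (∑ m, a m • ν m) z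
  have hatomic : ∀ f ∈ S.extremePoints ℝ, ∃ K ≤ M, IsAtomicSum K f := fun f hf =>
    Fintype.card_fin M ▸ exists_isAtomicSum_of_mem_extremePoints (hset ▸ hf)
  refine ⟨⟨DirectProd.bijective_component, DirectProd.norm_eq_dualNorm⟩,
    ⟨hne, hconvex, hcompact⟩,
    ⟨a, fun n => ‖(∑ m, a m • ν m) n‖, fun f hf => hconj hf,
      fun f hf => DirectProd.norms_mem_dualDualityMap (hconj hf), fun hρ =>
      ⟨fun f hf n => DirectProd.scaling_pos hρ (hconj hf),
        fun n => DirectProd.exists_isRieszMap_component_eq hρ hconj,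
        fun n _ => DirectProd.exists_isDualityOperator_component_eq hρ hconj⟩⟩,
    fun hρ n => DirectProd.exists_image_component_eq_singleton hρ hconj hne,
    fun n => ⟨weakStar_eq_closure_convexHull (convex_image_comp _ hconvex)
      (isCompact_weakStar_image_comp _ hcompact), extremePoints_image_comp_subset _ hcompact⟩,
    fun f hf => ?_, fun hρ f hf => ?_⟩ <;> obtain ⟨L, hL, hfL⟩ := hatomic f hf
  · obtain ⟨K₀, hK₀, hleast⟩ := hfL.exists_isLeast
    exact ⟨K₀, hK₀.trans hL, hleast, DirectProd.isAtomicSum_component hleast.1⟩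
  · obtain ⟨K, c, e, hK, h⟩ := DirectProd.exists_sum_dualAtoms_eq_component hρ hfL
    exact ⟨K, c, e, hK.trans hL, h⟩

theorem theorem2 {M N : ℕ} (X : Fin N → Type*) [∀ n, NormedAddCommGroup (X n)]
    [∀ n, NormedSpace ℝ (X n)] [∀ n, CompleteSpace (X n)] (ρ : AbsoluteNorm N)
    (ν : Fin M → DirectProd ρ X) (hν : LinearIndependent ℝ ν)
    (E : (Fin M → ℝ) → (Fin M → ℝ) → ℝ≥0∞) (y : Fin M → ℝ)
    (hE_proper : ∃ z, E y z ≠ ∞) (hE_lsc : LowerSemicontinuous (E y))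
    (hE_strict : EStrictConvex (E y))
    (ψ : ℝ≥0 → ℝ≥0) (hψ_mono : StrictMono ψ) (hψ_strict : StrictConvexOn ℝ≥0 Set.univ ψ)
    (S : Set (StrongDual ℝ (DirectProd ρ X))) (hS : S = solutionSet E y ν ψ) :
    -- the dual of `X` is the direct product of the duals with the dual outer norm
    (Function.Bijective
        (fun (f : StrongDual ℝ (DirectProd ρ X)) (n : Fin N) => DirectProd.component n f) ∧
      ∀ f : StrongDual ℝ (DirectProd ρ X), ‖f‖ = ρ.dualNorm (DirectProd.componentNorms f)) ∧
    (S.Nonempty ∧ Convex ℝ S ∧ IsCompact (weakStar S)) ∧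
    -- all solutions are conjugates of a common `ν₀ = ∑ a_m ν_m`
    (∃ (a : Fin M → ℝ) (ystar : Fin N → ℝ),
      (∀ f ∈ S, f ∈ dualityMap (∑ m, a m • ν m)) ∧
      (∀ f ∈ S, ystar ∈ ρ.dualDualityMap (DirectProd.componentNorms f)) ∧
      (ρ.DualStrictConvex ∨ ρ.DualIsL1 →
        (∀ f ∈ S, ∀ n, DirectProd.componentNorms f n ≠ 0 →
          0 < scaling (DirectProd.componentNorms f) ystar n) ∧
        -- Hilbert components
        (∀ n, HasHilbertNorm (StrongDual ℝ (X n)) →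
          ∃ R : X n →L[ℝ] StrongDual ℝ (X n), IsRieszMap R ∧ IsDualityOperator R ∧
            ∀ f ∈ S, DirectProd.component n f =
              scaling (DirectProd.componentNorms f) ystar n • ∑ m, a m • R (ν m n)) ∧
        -- strictly convex components
        (∀ n, StrictConvexSpace ℝ (StrongDual ℝ (X n)) →
          ∃ J : X n → StrongDual ℝ (X n), IsDualityOperator J ∧
            ∀ f ∈ S, DirectProd.component n f =
              scaling (DirectProd.componentNorms f) ystar n • J (∑ m, a m • ν m n)))) ∧
    -- uniqueness of the Hilbert and of the strictly convex components
    (ρ.DualStrictConvex →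
      ∀ n, HasHilbertNorm (StrongDual ℝ (X n)) ∨ StrictConvexSpace ℝ (StrongDual ℝ (X n)) →
        ∃ g, DirectProd.component n '' S = {g}) ∧
    -- general components, in particular those that are not strictly convex
    (∀ n,
      weakStar (DirectProd.component n '' S) =
        closure (convexHull ℝ (weakStar (Set.extremePoints ℝ (DirectProd.component n '' S)))) ∧
      Set.extremePoints ℝ (DirectProd.component n '' S) ⊆
        DirectProd.component n '' Set.extremePoints ℝ S) ∧
    (∀ f ∈ Set.extremePoints ℝ S, ∃ K₀ ≤ M, IsLeast {K | IsAtomicSum K f} K₀ ∧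
      ∀ n, IsAtomicSum K₀ (DirectProd.component n f)) ∧
    -- outer `ℓ¹` norm
    (ρ.DualIsL1 → ∀ f ∈ Set.extremePoints ℝ S,
      ∃ (K : Fin N → ℕ) (c : ∀ n, Fin (K n) → ℝ) (e : ∀ n, Fin (K n) → StrongDual ℝ (X n)),
        ∑ n, K n ≤ M ∧
        ∀ n, (∀ k, e n k ∈ dualAtoms (X n)) ∧
          DirectProd.component n f = ∑ k, c n k • e n k ∧
          (StrictConvexSpace ℝ (StrongDual ℝ (X n)) → DirectProd.component n f ≠ 0 →
            K n = 1 ∧ ∀ k, c n k = ‖DirectProd.component n f‖ ∧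
              e n k = ‖DirectProd.component n f‖⁻¹ • DirectProd.component n f)) := by
  obtain ⟨z, hz⟩ := hE_proper
  obtain ⟨f, rfl⟩ := measurement_surjective hν z
  exact theorem2_general X ρ ν E y ⟨f, hz⟩ hE_lsc hE_strict ψ hψ_mono hψ_strict.convexOn S hS
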